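/- Let $H_4$ be the complex Lie algebra with basis $a,b,c,d$ and brackets $[a,b]=c$, $[d,a]=a$, $[d,b]=-b$, $[c,d]=[c,a]=[c,b]=0$, and let $(\cdot,\cdot)$ be the symmetric invariant bilinear form on $H_4$ with $(a,b)=(c,d)=1$ and all other pairings of basis vectors equal to $0$. Let $\widehat H_4=H_4\otimes\mathbb C[t,t^{-1}]\oplus\mathbb C\mathbf k$ with $\mathbf k$ central and $[x\otimes t^m,y\otimes t^n]=[x,y]\otimes t^{m+n}+m(x,y)\delta_{m+n,0}\mathbf k$, and write $x(n)=x\otimes t^n$. Let $\tau$ be the automorphism of $H_4$ with $\tau a=b$, $\tau b=a$, $\tau c=-c$, $\tau d=-d$, and let $\hat\tau$ be the automorphism of $\widehat H_4$ with $\hat\tau(h\otimes t^m+s\mathbf k)=(-1)^m\tau(h)\otimes t^m+s\mathbf k$. The twisted affine Nappi–Witten Lie algebra is $\mathfrak g=\widehat H_4[\tau]=\{u\in\widehat H_4 : \hat\tau(u)=u\}$, and $\mathfrak g^{(+)}$ is its subalgebra spanned by $(a+b)(n)$ for even $n>0$ and $(a-b)(m)$, $c(m)$, $d(m)$ for odd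 $m>0$. Let $\psi:\mathfrak g^{(+)}\to\mathbb C$ be a Lie algebra homomorphism. A nonzero vector $v$ of a $\mathfrak g$-module is a Whittaker vector of type $\psi$ if $xv=\psi(x)v$ for all $x\in\mathfrak g^{(+)}$; a Whittaker module of type $\psi$ is a $\mathfrak g$-module generated by a Whittaker vector of type $\psi$. Let $\mathbb C_\psi$ be the one-dimensional $\mathfrak g^{(+)}$-module on which $x$ acts as $\psi(x)$, let $M_\psi=U(\mathfrak g)\otimes_{U(\mathfrak g^{(+)})}\mathbb C_\psi$ and, for $\xi\in\mathbb C$, let $L_{\psi,\xi}=M_\psi/(\mathbf k-\xi)M_\psi$, with $\bar\omega$ the image of $1\otimes 1$ in $L_{\psi,\xi}$. **Theorem.** Assume that $\psi(c(1))\neq 0$ and $\xi\in\mathbb C$, $\xi\neq 0$. Then: (1) For $\omega'\in L_{\psi,\xi}$ the following are equivalent: $\omega'$ is a Whittaker vector of type $\psi$; $\omega'$ is a Whittaker vector of type $\psi'$ for some Lie algebra homomorphism $\psi':\mathfrak g^{(+)}\to\mathbb C$; $\omega'=u\bar\omega$ for some $u\in\mathbb C$ with $u\neq 0$. (2) $L_{\psi,\xi}$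 is an irreducible $\mathfrak g$-module. (3) Every Whittaker $\mathfrak g$-module of type $\psi$ on which $\mathbf k$ acts as the scalar $\xi$ is irreducible and isomorphic to $L_{\psi,\xi}$. -/

import Mathlib

open scoped TensorProduct

noncomputable section

/-! ### Induced modules -/

section Induced

attribute [local instance 100] LieRing.ofAssociativeRing

variable (R L V : Type*) [CommRing R] [LieRing L] [LieAlgebra R L] (K : LieSubalgebra R L)
  [AddCommGroup V] [Module R V] [LieRingModule K V] [LieModule R K V]

/-- The algebra map `U(K) → U(L)` induced by the inclusion of a Lie subalgebra. -/
def envelopingIncl : UniversalEnvelopingAlgebra R K →ₐ[R] UniversalEnvelopingAlgebra R L :=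
  UniversalEnvelopingAlgebra.lift R ((UniversalEnvelopingAlgebra.ι R).comp K.incl)

/-- The action of `U(K)` on a `K`-module. -/
def envelopingAct : UniversalEnvelopingAlgebra R K →ₐ[R] Module.End R V :=
  UniversalEnvelopingAlgebra.lift R (LieModule.toEnd R K V)

/-- The relations `us ⊗ v = u ⊗ sv`, `s ∈ U(K)`, that balance `U(L) ⊗_R V` over `U(K)`. -/
def inducedRelations :
    Submodule (UniversalEnvelopingAlgebra R L) (UniversalEnvelopingAlgebra R L ⊗[R] V) :=
  Submodule.span (UniversalEnvelopingAlgebra R L)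
    {z | ∃ (u : UniversalEnvelopingAlgebra R L) (s : UniversalEnvelopingAlgebra R K) (v : V),
      z = (u * envelopingIncl R L K s) ⊗ₜ[R] v - u ⊗ₜ[R] (envelopingAct R L V K s v)}

/-- The induced module `U(L) ⊗_{U(K)} V`. -/
def InducedModule : Type _ :=
  (UniversalEnvelopingAlgebra R L ⊗[R] V) ⧸ inducedRelations R L V K

instance : AddCommGroup (InducedModule R L V K) :=
  inferInstanceAs (AddCommGroup ((UniversalEnvelopingAlgebra R L ⊗[R] V) ⧸
    inducedRelations R L V K))

instance : Module (UniversalEnvelopingAlgebra R L) (InducedModule R L V K) :=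
  inferInstanceAs (Module (UniversalEnvelopingAlgebra R L)
    ((UniversalEnvelopingAlgebra R L ⊗[R] V) ⧸ inducedRelations R L V K))

instance : Module R (InducedModule R L V K) :=
  inferInstanceAs (Module R ((UniversalEnvelopingAlgebra R L ⊗[R] V) ⧸ inducedRelations R L V K))

instance : IsScalarTower R (UniversalEnvelopingAlgebra R L) (InducedModule R L V K) :=
  inferInstanceAs (IsScalarTower R (UniversalEnvelopingAlgebra R L)
    ((UniversalEnvelopingAlgebra R L ⊗[R] V) ⧸ inducedRelations R L V K))

instance : LieRingModule L (InducedModule R L V K) where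
  bracket x m := UniversalEnvelopingAlgebra.ι R x • m
  add_lie x y m := by
    change UniversalEnvelopingAlgebra.ι R (x + y) • m = _ • m + _ • m
    rw [map_add, add_smul]
  lie_add x m n := smul_add _ m n
  leibniz_lie x y m := by
    change _ • _ • m = UniversalEnvelopingAlgebra.ι R ⁅x, y⁆ • m + _ • _ • m
    rw [LieHom.map_lie, LieRing.of_associative_ring_bracket, sub_smul, mul_smul, mul_smul,
      sub_add_cancel]

instance : LieModule R L (InducedModule R L V K) where
  smul_lie r x m := by
    change UniversalEnvelopingAlgebra.ι R (r • x) • m = r • UniversalEnvelopingAlgebra.ι R x • m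
    rw [map_smul, smul_assoc]
  lie_smul r x m := by
    change UniversalEnvelopingAlgebra.ι R x • r • m = r • UniversalEnvelopingAlgebra.ι R x • m
    exact smul_algebra_smul_comm r _ m

/-- The class of `u ⊗ v` in the induced module. -/
def InducedModule.tmul (u : UniversalEnvelopingAlgebra R L) (v : V) : InducedModule R L V K :=
  Submodule.Quotient.mk (u ⊗ₜ[R] v)

end Induced

/-- The one-dimensional module on which a Lie algebra acts through a character `ψ`. -/
def CharModule {N : Type*} [LieRing N] [LieAlgebra ℂ N] (_ψ : LieAlgebra.LieCharacter ℂ N) : Type :=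
  ℂ

namespace CharModule

variable {N : Type*} [LieRing N] [LieAlgebra ℂ N] (ψ : LieAlgebra.LieCharacter ℂ N)

instance : AddCommGroup (CharModule ψ) := inferInstanceAs (AddCommGroup ℂ)

instance : Module ℂ (CharModule ψ) := inferInstanceAs (Module ℂ ℂ)

instance : LieRingModule N (CharModule ψ) where
  bracket x z := ψ x • z
  add_lie x y z := by
    rw [map_add, add_smul]
  lie_add x y z := smul_add (ψ x) y z
  leibniz_lie x y z := by
    change ψ x • ψ y • z = ψ ⁅x, y⁆ • z + ψ y • ψ x • z
    rw [LieAlgebra.lieCharacter_apply_lie, zero_smul, zero_add, smul_comm]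

instance : LieModule ℂ N (CharModule ψ) where
  smul_lie r x z := by
    change ψ (r • x) • z = r • ψ x • z
    rw [map_smul, smul_assoc]
  lie_smul r x z := smul_comm (ψ x) r z

/-- The basis vector `1`. -/
def one : CharModule ψ := (1 : ℂ)

end CharModule

/-! ### The Nappi-Witten Lie algebra -/

/-- The underlying space of `H₄`: the vector `x` stands for `x 0 • a + x 1 • b + x 2 • c + x 3 • d`. -/
def NappiWitten : Type := Fin 4 → ℂ

namespace NappiWitten

instance : AddCommGroup NappiWitten := inferInstanceAs (AddCommGroup (Fin 4 → ℂ))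

instance : Module ℂ NappiWitten := inferInstanceAs (Module ℂ (Fin 4 → ℂ))

@[ext] theorem ext {x y : NappiWitten} (h0 : x 0 = y 0) (h1 : x 1 = y 1) (h2 : x 2 = y 2)
    (h3 : x 3 = y 3) : x = y := by
  funext i
  fin_cases i <;> assumption

@[simp] theorem add_apply (x y : NappiWitten) (i : Fin 4) : (x + y) i = x i + y i := rfl
@[simp] theorem sub_apply (x y : NappiWitten) (i : Fin 4) : (x - y) i = x i - y i := rfl
@[simp] theorem neg_apply (x : NappiWitten) (i : Fin 4) : (-x) i = -x i := rfl
@[simp] theorem zero_apply (i : Fin 4) : (0 : NappiWitten) i = 0 := rfl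
@[simp] theorem smul_apply (r : ℂ) (x : NappiWitten) (i : Fin 4) : (r • x) i = r * x i := rfl

/-- The element of `H₄` with given coordinates in the basis `a, b, c, d`. -/
def mk (p q r s : ℂ) : NappiWitten := ![p, q, r, s]

@[simp] theorem mk_zero (p q r s : ℂ) : mk p q r s 0 = p := rfl
@[simp] theorem mk_one (p q r s : ℂ) : mk p q r s 1 = q := rfl
@[simp] theorem mk_two (p q r s : ℂ) : mk p q r s 2 = r := rfl
@[simp] theorem mk_three (p q r s : ℂ) : mk p q r s 3 = s := rfl

/-- The basis vector `a`. -/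
def a : NappiWitten := mk 1 0 0 0
/-- The basis vector `b`. -/
def b : NappiWitten := mk 0 1 0 0
/-- The basis vector `c`. -/
def c : NappiWitten := mk 0 0 1 0
/-- The basis vector `d`. -/
def d : NappiWitten := mk 0 0 0 1

instance : Bracket NappiWitten NappiWitten where
  bracket x y := mk (x 3 * y 0 - x 0 * y 3) (x 1 * y 3 - x 3 * y 1) (x 0 * y 1 - x 1 * y 0) 0

theorem lie_def (x y : NappiWitten) : ⁅x, y⁆ =
    mk (x 3 * y 0 - x 0 * y 3) (x 1 * y 3 - x 3 * y 1) (x 0 * y 1 - x 1 * y 0) 0 := rfl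

instance : LieRing NappiWitten where
  add_lie x y z := by ext <;> simp [lie_def] <;> ring
  lie_add x y z := by ext <;> simp [lie_def] <;> ring
  lie_self x := by ext <;> simp [lie_def] <;> ring
  leibniz_lie x y z := by ext <;> simp [lie_def] <;> ring

instance : LieAlgebra ℂ NappiWitten where
  lie_smul r x y := by ext <;> simp [lie_def] <;> ring

/-- The defining relations of `H₄`. -/
theorem relations : ⁅a, b⁆ = c ∧ ⁅d, a⁆ = a ∧ ⁅d, b⁆ = -b ∧ ⁅c, d⁆ = 0 ∧ ⁅c, a⁆ = 0 ∧
    ⁅c, b⁆ = 0 := by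
  refine ⟨?_, ?_, ?_, ?_, ?_, ?_⟩ <;> ext <;> simp [lie_def, a, b, c, d]

/-- The invariant form: `(a,b) = (c,d) = 1`, all other pairings of basis vectors are `0`. -/
def form : LinearMap.BilinForm ℂ NappiWitten :=
  LinearMap.mk₂ ℂ (fun x y => x 0 * y 1 + x 1 * y 0 + x 2 * y 3 + x 3 * y 2)
    (fun x y z => by simp; ring) (fun r x y => by simp; ring)
    (fun x y z => by simp; ring) (fun r x y => by simp; ring)

theorem form_apply (x y : NappiWitten) :
    form x y = x 0 * y 1 + x 1 * y 0 + x 2 * y 3 + x 3 * y 2 := rfl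

theorem form_isSymm : form.IsSymm :=
  ⟨fun x y => by simp [form_apply]; ring⟩

theorem form_lieInvariant : form.lieInvariant NappiWitten := fun x y z => by
  simp [form_apply, lie_def]; ring

/-- The involution `τ`: `a ↔ b`, `c ↦ -c`, `d ↦ -d`. -/
def τ : NappiWitten →ₗ⁅ℂ⁆ NappiWitten where
  toFun x := mk (x 1) (x 0) (-x 2) (-x 3)
  map_add' x y := by ext <;> simp <;> ring
  map_smul' r x := by ext <;> simp
  map_lie' {x y} := by ext <;> simp [lie_def] <;> ring

theorem τ_apply (x : NappiWitten) : τ x = mk (x 1) (x 0) (-x 2) (-x 3) := rfl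

theorem form_τ (x y : NappiWitten) : form (τ x) (τ y) = form x y := by
  simp [form_apply, τ_apply]; ring

end NappiWitten

/-! ### The affine Nappi-Witten Lie algebra and its twisted form -/

open LieAlgebra in
/-- The cocycle `(x ⊗ t^m, y ⊗ t^n) ↦ m (x, y) δ_{m+n,0}`. The residue cocycle of the library has
`n` in place of `m`, hence the sign. -/
def affineCocycle : LieModule.Cohomology.twoCocycle ℂ (loopAlgebra ℂ ℤ NappiWitten)
    (TrivialLieModule ℂ (loopAlgebra ℂ ℤ NappiWitten) ℂ) :=
  (-1 : ℂ) • LoopAlgebra.twoCocycleOfBilinear ℂ ℤ NappiWitten NappiWitten.form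
    NappiWitten.form_lieInvariant NappiWitten.form_isSymm

/-- The untwisted affine algebra `H₄ ⊗ ℂ[t, t⁻¹] ⊕ ℂ k`. -/
abbrev AffineNW : Type := LieAlgebra.ofTwoCocycle affineCocycle

namespace AffineNW

open LieAlgebra

/-- An element of the affine algebra from its loop part and the coefficient of `k`. -/
def mk (f : loopAlgebra ℂ ℤ NappiWitten) (s : ℂ) : AffineNW :=
  ofProd affineCocycle (f, (TrivialLieModule.equiv ℂ (loopAlgebra ℂ ℤ NappiWitten) ℂ).symm s)

/-- The loop part. -/
def loop : AffineNW →ₗ[ℂ] loopAlgebra ℂ ℤ NappiWitten where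
  toFun u := ((ofProd affineCocycle).symm u).1
  map_add' _ _ := rfl
  map_smul' _ _ := rfl

/-- The coefficient of `k`. -/
def central : AffineNW →ₗ[ℂ] ℂ where
  toFun u := TrivialLieModule.equiv ℂ (loopAlgebra ℂ ℤ NappiWitten) ℂ
    ((ofProd affineCocycle).symm u).2
  map_add' _ _ := rfl
  map_smul' _ _ := rfl

@[simp] theorem loop_mk (f : loopAlgebra ℂ ℤ NappiWitten) (s : ℂ) : loop (mk f s) = f := rfl
@[simp] theorem central_mk (f : loopAlgebra ℂ ℤ NappiWitten) (s : ℂ) : central (mk f s) = s := rfl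

theorem ext {u v : AffineNW} (h1 : loop u = loop v) (h2 : central u = central v) : u = v :=
  (ofProd affineCocycle).symm.injective (Prod.ext h1 h2)

/-- `x(n) = x ⊗ t^n`. -/
def mode (x : NappiWitten) (n : ℤ) : AffineNW := mk (AddMonoidAlgebra.single n 1 ⊗ₜ[ℂ] x) 0

/-- The central element `k`. -/
def k : AffineNW := mk 0 1

theorem loop_lie (u v : AffineNW) : loop ⁅u, v⁆ = ⁅loop u, loop v⁆ := rfl

theorem affineCocycle_apply (f g : loopAlgebra ℂ ℤ NappiWitten) :
    (affineCocycle : loopAlgebra ℂ ℤ NappiWitten →ₗ[ℂ] loopAlgebra ℂ ℤ NappiWitten →ₗ[ℂ]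
      TrivialLieModule ℂ (loopAlgebra ℂ ℤ NappiWitten) ℂ) f g =
    (TrivialLieModule.equiv ℂ (loopAlgebra ℂ ℤ NappiWitten) ℂ).symm
      (-LoopAlgebra.residuePairing ℂ ℤ NappiWitten NappiWitten.form f g) := by
  rw [← neg_one_mul]
  rfl

theorem central_lie (u v : AffineNW) : central ⁅u, v⁆ =
    -LoopAlgebra.residuePairing ℂ ℤ NappiWitten NappiWitten.form (loop u) (loop v) := by
  change TrivialLieModule.equiv ℂ (loopAlgebra ℂ ℤ NappiWitten) ℂ (_ + ⁅_, _⁆ - ⁅_, _⁆) = _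
  rw [trivial_lie_zero, trivial_lie_zero, add_zero, sub_zero]
  erw [affineCocycle_apply]
  rfl

theorem residue_tmul (x y : NappiWitten) (m n : ℤ) :
    LoopAlgebra.residuePairing ℂ ℤ NappiWitten NappiWitten.form
      (AddMonoidAlgebra.single m 1 ⊗ₜ[ℂ] x) (AddMonoidAlgebra.single n 1 ⊗ₜ[ℂ] y) =
    if m + n = 0 then -((m : ℂ) * NappiWitten.form x y) else 0 := by
  rw [LoopAlgebra.residuePairing_apply_apply, LoopAlgebra.toFinsupp_single_tmul,
    LoopAlgebra.toFinsupp_single_tmul, Finsupp.sum_single_index (by simp)]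
  split_ifs with h
  · obtain rfl : n = -m := by lia
    simp
  · rw [Finsupp.single_eq_of_ne (by lia)]
    simp

theorem lie_mode_mode (x y : NappiWitten) (m n : ℤ) :
    ⁅mode x m, mode y n⁆ =
      mode ⁅x, y⁆ (m + n) + (if m + n = 0 then (m : ℂ) * NappiWitten.form x y else 0) • k := by
  apply ext
  · rw [loop_lie, map_add, map_smul]
    simp only [mode, k, loop_mk, smul_zero, add_zero, LieAlgebra.ExtendScalars.bracket_tmul]
    rw [AddMonoidAlgebra.single_mul_single, one_mul]
  · rw [central_lie, map_add, map_smul]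
    simp only [mode, k, loop_mk, central_mk]
    rw [residue_tmul]
    split_ifs <;> simp

theorem lie_k (u : AffineNW) : ⁅u, k⁆ = 0 := by
  apply ext
  · exact lie_zero (M := loopAlgebra ℂ ℤ NappiWitten) (loop u)
  · rw [central_lie]
    simp [k]

theorem mode_add (x y : NappiWitten) (n : ℤ) : mode (x + y) n = mode x n + mode y n :=
  ext (TensorProduct.tmul_add _ _ _) (add_zero (0 : ℂ)).symm

theorem mode_smul (r : ℂ) (x : NappiWitten) (n : ℤ) : mode (r • x) n = r • mode x n :=
  ext (TensorProduct.tmul_smul r _ _) (mul_zero r).symm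

theorem induction {P : AffineNW → Prop} (h_add : ∀ u v, P u → P v → P (u + v))
    (h_mode : ∀ x n, P (mode x n)) (h_k : ∀ r : ℂ, P (r • k)) (u : AffineNW) : P u := by
  have h_loop : ∀ f, P (mk f 0) := by
    intro f
    induction f using TensorProduct.induction_on with
    | zero => exact (ext (by simp [k]) (by simp [k]) : (0 : ℂ) • k = mk 0 0) ▸ h_k 0
    | add f g hf hg =>
      have h : mk f 0 + mk g 0 = mk (f + g) 0 := ext rfl (add_zero (0 : ℂ))
      exact h ▸ h_add _ _ hf hg
    | tmul p x =>
      induction p using AddMonoidAlgebra.induction_linear with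
      | zero => exact (ext (by simp [k]) (by simp [k]) : (0 : ℂ) • k = mk (0 ⊗ₜ[ℂ] x) 0) ▸ h_k 0
      | add p q hp hq =>
        have h : mk (p ⊗ₜ[ℂ] x) 0 + mk (q ⊗ₜ[ℂ] x) 0 = mk ((p + q) ⊗ₜ[ℂ] x) 0 :=
          ext (TensorProduct.add_tmul p q x).symm (add_zero (0 : ℂ))
        exact h ▸ h_add _ _ hp hq
      | single n r =>
        have h : mode (r • x) n = mk (AddMonoidAlgebra.single n r ⊗ₜ[ℂ] x) 0 := by
          refine ext ?_ rfl
          simp only [mode, loop_mk]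
          rw [← TensorProduct.smul_tmul, AddMonoidAlgebra.smul_single, smul_eq_mul, mul_one]
        exact h ▸ h_mode _ _
  have h : mk (loop u) 0 + central u • k = u := ext (by simp [k]) (by simp [k])
  exact h ▸ h_add _ _ (h_loop _) (h_k _)

/-- The substitution `t^m ↦ (-1)^m t^m` on Laurent polynomials. -/
def signTwist : AddMonoidAlgebra ℂ ℤ →ₐ[ℂ] AddMonoidAlgebra ℂ ℤ :=
  AddMonoidAlgebra.lift ℂ (AddMonoidAlgebra ℂ ℤ) ℤ
    { toFun m := AddMonoidAlgebra.single m.toAdd ((-1 : ℂ) ^ m.toAdd)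
      map_one' := by rw [toAdd_one, zpow_zero, AddMonoidAlgebra.one_def]
      map_mul' m n := by
        rw [AddMonoidAlgebra.single_mul_single, toAdd_mul, zpow_add₀ (by norm_num)] }

/-- The underlying linear map of the automorphism `τHat`. -/
def τLin : AffineNW →ₗ[ℂ] AffineNW where
  toFun u := mk (TensorProduct.map signTwist.toLinearMap
    (NappiWitten.τ : NappiWitten →ₗ[ℂ] NappiWitten) (loop u)) (central u)
  map_add' u v := ext (by simp) (by simp)
  map_smul' r u := ext (by simp) (by simp)

theorem τLin_k : τLin k = k := ext (by simp [τLin, k]) (by simp [τLin, k])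

theorem τLin_mode (x : NappiWitten) (n : ℤ) :
    τLin (mode x n) = (-1 : ℂ) ^ n • mode (NappiWitten.τ x) n := by
  refine ext ?_ (by simp [τLin, mode])
  simp only [τLin, mode, LinearMap.coe_mk, AddHom.coe_mk, loop_mk, map_smul,
    TensorProduct.map_tmul, AlgHom.toLinearMap_apply, signTwist, AddMonoidAlgebra.lift_single]
  rw [TensorProduct.smul_tmul', AddMonoidAlgebra.smul_single, smul_eq_mul, mul_one, one_smul]
  rfl

/-- The automorphism `h ⊗ t^m + s k ↦ (-1)^m τ(h) ⊗ t^m + s k`. -/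
def τHat : AffineNW →ₗ⁅ℂ⁆ AffineNW where
  __ := τLin
  map_lie' {u v} := by
    change τLin ⁅u, v⁆ = ⁅τLin u, τLin v⁆
    induction v using induction with
    | h_add v w hv hw => rw [lie_add, map_add, map_add, lie_add, hv, hw]
    | h_k r => rw [map_smul, lie_smul, lie_smul, lie_k, τLin_k, lie_k, map_smul, map_zero]
    | h_mode y n =>
      induction u using induction with
      | h_add u w hu hw => rw [add_lie, map_add, map_add, add_lie, hu, hw]
      | h_k r =>
        rw [map_smul, smul_lie, smul_lie, τLin_k, ← lie_skew, lie_k, ← lie_skew k, lie_k, neg_zero,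
          smul_zero, map_zero]
      | h_mode x m =>
        rw [lie_mode_mode, map_add, map_smul, τLin_k, τLin_mode, τLin_mode, τLin_mode, smul_lie,
          lie_smul, lie_mode_mode, NappiWitten.form_τ, LieHom.map_lie, smul_smul, smul_add,
          ← zpow_add₀ (by norm_num)]
        congr 1
        split_ifs with h
        · rw [h, zpow_zero, one_smul]
        · rw [zero_smul, smul_zero]

theorem τHat_mode (x : NappiWitten) (n : ℤ) :
    τHat (mode x n) = (-1 : ℂ) ^ n • mode (NappiWitten.τ x) n := τLin_mode x n

theorem τHat_k : τHat k = k := τLin_k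

end AffineNW

/-- The twisted affine algebra: the fixed points of `τHat` in the affine algebra. -/
def TwistedNW : LieSubalgebra ℂ AffineNW where
  carrier := {u | AffineNW.τHat u = u}
  add_mem' {u v} hu hv := by
    change AffineNW.τHat (u + v) = u + v
    rw [map_add, hu, hv]
  zero_mem' := map_zero _
  smul_mem' r u hu := by
    change AffineNW.τHat (r • u) = r • u
    rw [map_smul, hu]
  lie_mem' {u v} hu hv := by
    change AffineNW.τHat ⁅u, v⁆ = ⁅u, v⁆
    rw [LieHom.map_lie, hu, hv]

namespace TwistedNW

open AffineNW

theorem mode_mem {x : NappiWitten} {n : ℤ} (h : NappiWitten.τ x = (-1 : ℂ) ^ n • x) :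
    mode x n ∈ TwistedNW := by
  change τHat (mode x n) = mode x n
  rw [τHat_mode, h, mode_smul, smul_smul, ← zpow_add₀ (by norm_num), Even.neg_one_zpow ⟨n, rfl⟩,
    one_smul]

/-- The central element `k` of the twisted algebra. -/
def k : TwistedNW := ⟨AffineNW.k, τHat_k⟩

theorem lie_k (u : TwistedNW) : ⁅u, k⁆ = 0 := Subtype.ext (AffineNW.lie_k u)

open NappiWitten in
/-- The vectors `(a+b)(n)`, for even `n > 0`, and `(a-b)(n)`, `c(n)`, `d(n)`, for odd `n > 0`. -/
def positiveModes : Set TwistedNW :=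
  {u | ∃ n : ℤ, 0 < n ∧ ((Even n ∧ (u : AffineNW) = mode (a + b) n) ∨
    (Odd n ∧ ((u : AffineNW) = mode (a - b) n ∨ (u : AffineNW) = mode c n ∨
      (u : AffineNW) = mode d n)))}

open NappiWitten in
theorem mode_mem_span {x : NappiWitten} {n : ℤ} (hn : 0 < n)
    (h : NappiWitten.τ x = (-1 : ℂ) ^ n • x) :
    (⟨mode x n, mode_mem h⟩ : TwistedNW) ∈ Submodule.span ℂ positiveModes := by
  rcases Int.even_or_odd n with he | ho
  · have h1 : NappiWitten.τ (a + b) = (-1 : ℂ) ^ n • (a + b) := by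
      rw [he.neg_one_zpow]
      ext <;> simp [τ_apply, a, b]
    have hx : x = x 0 • (a + b) := by
      rw [he.neg_one_zpow, one_smul] at h
      have e0 := congrFun h 0
      have e2 := congrFun h 2
      have e3 := congrFun h 3
      simp only [τ_apply, NappiWitten.mk_zero, mk_two, mk_three] at e0 e2 e3
      ext <;> simp [a, b]
      · exact e0
      · linear_combination (-1 / 2 : ℂ) * e2
      · linear_combination (-1 / 2 : ℂ) * e3
    have hs : (⟨mode x n, mode_mem h⟩ : TwistedNW) = x 0 • ⟨mode (a + b) n, mode_mem h1⟩ := by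
      apply Subtype.ext
      change mode x n = x 0 • mode (a + b) n
      rw [← mode_smul, ← hx]
    rw [hs]
    exact Submodule.smul_mem _ _ (Submodule.subset_span ⟨n, hn, Or.inl ⟨he, rfl⟩⟩)
  · have h1 : NappiWitten.τ (a - b) = (-1 : ℂ) ^ n • (a - b) := by
      rw [ho.neg_one_zpow]
      ext <;> simp [τ_apply, a, b]
    have h2 : NappiWitten.τ c = (-1 : ℂ) ^ n • c := by
      rw [ho.neg_one_zpow]
      ext <;> simp [τ_apply, c]
    have h3 : NappiWitten.τ d = (-1 : ℂ) ^ n • d := by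
      rw [ho.neg_one_zpow]
      ext <;> simp [τ_apply, d]
    have hx : x = x 0 • (a - b) + x 2 • c + x 3 • d := by
      rw [ho.neg_one_zpow] at h
      have e0 := congrFun h 0
      simp only [τ_apply, NappiWitten.mk_zero, NappiWitten.smul_apply] at e0
      ext <;> simp [a, b, c, d]
      linear_combination e0
    have hs : (⟨mode x n, mode_mem h⟩ : TwistedNW) = x 0 • ⟨mode (a - b) n, mode_mem h1⟩ +
        x 2 • ⟨mode c n, mode_mem h2⟩ + x 3 • ⟨mode d n, mode_mem h3⟩ := by
      apply Subtype.ext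
      change mode x n = x 0 • mode (a - b) n + x 2 • mode c n + x 3 • mode d n
      rw [← mode_smul, ← mode_smul, ← mode_smul, ← mode_add, ← mode_add, ← hx]
    rw [hs]
    refine Submodule.add_mem _ (Submodule.add_mem _ ?_ ?_) ?_ <;>
      refine Submodule.smul_mem _ _ (Submodule.subset_span ⟨n, hn, Or.inr ⟨ho, ?_⟩⟩)
    exacts [Or.inl rfl, Or.inr (Or.inl rfl), Or.inr (Or.inr rfl)]

open NappiWitten in
theorem exists_of_mem_positiveModes {u : TwistedNW} (hu : u ∈ positiveModes) :
    ∃ (n : ℤ) (x : NappiWitten), 0 < n ∧ τ x = (-1 : ℂ) ^ n • x ∧ (u : AffineNW) = mode x n := by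
  obtain ⟨n, hn, ⟨he, h⟩ | ⟨ho, h | h | h⟩⟩ := hu
  · refine ⟨n, _, hn, ?_, h⟩
    rw [he.neg_one_zpow]
    ext <;> simp [τ_apply, a, b]
  all_goals
    refine ⟨n, _, hn, ?_, h⟩
    rw [ho.neg_one_zpow]
    ext <;> simp [τ_apply, a, b, c, d]

/-- The positive part: the span of the positive modes, which is closed under the bracket. -/
def positive : LieSubalgebra ℂ TwistedNW where
  __ := Submodule.span ℂ positiveModes
  lie_mem' {u v} hu hv := by
    change u ∈ Submodule.span ℂ positiveModes at hu
    change v ∈ Submodule.span ℂ positiveModes at hv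
    change ⁅u, v⁆ ∈ Submodule.span ℂ positiveModes
    induction hu, hv using Submodule.span_induction₂ with
    | zero_left v hv => rw [zero_lie]; exact Submodule.zero_mem _
    | zero_right u hu => rw [lie_zero]; exact Submodule.zero_mem _
    | add_left x y z _ _ _ h1 h2 => rw [add_lie]; exact Submodule.add_mem _ h1 h2
    | add_right x y z _ _ _ h1 h2 => rw [lie_add]; exact Submodule.add_mem _ h1 h2
    | smul_left r x y _ _ h => rw [smul_lie]; exact Submodule.smul_mem _ _ h
    | smul_right r x y _ _ h => rw [lie_smul]; exact Submodule.smul_mem _ _ h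
    | mem_mem u v hu hv =>
      obtain ⟨m, x, hm, hx, h1⟩ := exists_of_mem_positiveModes hu
      obtain ⟨n, y, hn, hy, h2⟩ := exists_of_mem_positiveModes hv
      have hxy : NappiWitten.τ ⁅x, y⁆ = (-1 : ℂ) ^ (m + n) • ⁅x, y⁆ := by
        rw [LieHom.map_lie, hx, hy, smul_lie, lie_smul, smul_smul, zpow_add₀ (by norm_num)]
      have h : ⁅u, v⁆ = ⟨mode ⁅x, y⁆ (m + n), mode_mem hxy⟩ := by
        apply Subtype.ext
        change ⁅(u : AffineNW), (v : AffineNW)⁆ = _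
        rw [h1, h2, lie_mode_mode, if_neg (by lia), zero_smul, add_zero]
      rw [h]
      exact mode_mem_span (by lia) hxy

/-- The element `c(1)` of the twisted algebra. -/
def cOne : TwistedNW := ⟨mode NappiWitten.c 1, mode_mem (by
  ext <;> simp [NappiWitten.τ_apply, NappiWitten.c])⟩

/-- `c(1)` as an element of the positive part. -/
def cOnePos : positive :=
  ⟨cOne, Submodule.subset_span ⟨1, one_pos, Or.inr ⟨odd_one, Or.inr (Or.inl rfl)⟩⟩⟩

end TwistedNW

/-! ### Whittaker modules -/

namespace TwistedNW

section Whittaker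

variable {M : Type*} [AddCommGroup M] [Module ℂ M] [LieRingModule TwistedNW M]

/-- Whittaker vectors of type `ψ`. -/
def IsWhittakerVector (ψ : LieAlgebra.LieCharacter ℂ positive) (v : M) : Prop :=
  v ≠ 0 ∧ ∀ x : positive, ⁅(x : TwistedNW), v⁆ = ψ x • v

variable (M) in
/-- Whittaker modules of type `ψ`: those generated by a Whittaker vector of type `ψ`. -/
def IsWhittakerModule (ψ : LieAlgebra.LieCharacter ℂ positive) : Prop :=
  ∃ ω : M, IsWhittakerVector ψ ω ∧ LieSubmodule.lieSpan ℂ TwistedNW {ω} = ⊤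

end Whittaker

variable (ψ : LieAlgebra.LieCharacter ℂ positive) (ξ : ℂ)

/-- The universal Whittaker module `M_ψ = U(g) ⊗_{U(g⁺)} ℂ_ψ`. -/
abbrev UniversalWhittaker : Type := InducedModule ℂ TwistedNW (CharModule ψ) positive

/-- The submodule `(k - ξ) M_ψ`. -/
def kSubScalar : LieSubmodule ℂ TwistedNW (UniversalWhittaker ψ) where
  __ := LinearMap.range
    (LieModule.toEnd ℂ TwistedNW (UniversalWhittaker ψ) k - ξ • (1 : Module.End ℂ _))
  lie_mem {x m} hm := by
    obtain ⟨n, rfl⟩ := hm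
    refine ⟨⁅x, n⁆, ?_⟩
    change ⁅k, ⁅x, n⁆⁆ - ξ • ⁅x, n⁆ = ⁅x, ⁅k, n⁆ - ξ • n⁆
    rw [lie_sub, lie_smul, leibniz_lie x k, lie_k, zero_lie, zero_add]

/-- The quotient `L_{ψ,ξ} = M_ψ / (k - ξ) M_ψ`. -/
abbrev WhittakerQuotient : Type := UniversalWhittaker ψ ⧸ kSubScalar ψ ξ

/-- The image of `1 ⊗ 1` in `L_{ψ,ξ}`. -/
def omegaBar : WhittakerQuotient ψ ξ :=
  LieSubmodule.Quotient.mk (InducedModule.tmul ℂ TwistedNW (CharModule ψ) positive 1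
    (CharModule.one ψ))

end TwistedNW

end

/-! Write A(n) for (a + (-1)^n b)(n), and take any module of nonzero level ξ generated by a
Whittaker vector ω of type ψ, with `f` a linear extension of ψ to the whole algebra. The commutation
relations alone show that the ordered monomials in d(-i), then A(-j), then c(-l), applied to ω, span
the module.

Let v be killed by u - f(u) for every positive u. Its factors are stripped in three rounds, each
time by lowering operators whose commutators with the raising operators are nonzero scalars. The
operators c(n) - f(c(n)) kill the monomials in A and c and remove the d(-n), because ξ ≠ 0. The
operators A(n+1) - f(A(n+1)) kill the monomials in c and remove the A(-n), because [A(n+1), A(-n)]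
is a nonzero multiple of c(1) and ψ(c(1)) ≠ 0. The operators d(n) - f(d(n)) remove the c(-n), again
because ξ ≠ 0. Only ℂω is left (`mem_span_singleton_of_eigen`); the linear algebra of one round is
`Lowering.mem_of_forall_eq_zero`.

Bracketing with a positive mode raises the mode index, so every vector is killed by all sufficiently
long products of operators u - f(u) (`exists_mem_whittakerFiltration`). In a nonzero submodule, a
nonzero vector that needs the shortest products is a Whittaker vector, hence a multiple of ω; this
is irreducibility (`isIrreducible_of_generator`). The same minimality shows that ψ is the only
possible type (`eigenvalue_eq`).

All this needs spanning, not independence. Independence of a PBW kind enters only in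
`omegaBar_ne_zero`: the algebra acts on polynomials in a complement of g⁺ ⊕ ℂk so that 1 has the
prescribed eigenvalues, and the universal property sends the generator of L_{ψ,ξ} to 1. The
universal property also maps L_{ψ,ξ} onto every Whittaker module of type ψ and level ξ, injectively
because L_{ψ,ξ} is irreducible. -/

set_option linter.unusedSectionVars false

noncomputable section

/-! ### Modules induced from a character, on the space of monomials -/

namespace InducedMonomials

variable {R g J K : Type*} [CommRing R] [LieRing g] [LieAlgebra R g] [LinearOrder J]
  (b : Module.Basis (J ⊕ K) R g) (χ : K → R)

variable (R) in
/-- The leading term of the action of a basis vector on a monomial. -/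
def leading : J ⊕ K → Multiset J → (Multiset J →₀ R)
  | .inl i, m => Finsupp.single (i ::ₘ m) 1
  | .inr _, _ => 0

open Classical in
/-- The action of the basis vectors on the monomials of degree at most `n`, by recursion on `n`. -/
def act : ℕ → J ⊕ K → Multiset J → (Multiset J →₀ R)
  -- With bound `0` only the empty monomial is meaningful; the values at other monomials are junk.
  | 0, .inl i, _ => Finsupp.single {i} 1
  | 0, .inr k, _ => Finsupp.single 0 (χ k)
  | n + 1, x, m =>
    if m.card ≤ n then act n x m else
      match m.sort (· ≤ ·) with
      -- Never reached, since `m` has more than `n` elements here.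
      | [] => 0
      | j :: l =>
        if ∃ i, x = .inl i ∧ i ≤ j then leading R x m else
          -- Forced by x(jl) = j(xl) + [x, j]l. In xl the leading term times j is the leading term
          -- of xm, as j is minimal; the rest has degree at most that of l, where the action of j is
          -- already defined.
          leading R x m +
            Finsupp.linearCombination R (act n (.inl j)) (act n x l - leading R x l) +
            b.constr R (fun z => act n z l) ⁅b x, b (.inl j)⁆

/-- The action of the Lie algebra on polynomials. -/
def op : g →ₗ[R] Module.End R (Multiset J →₀ R) :=
  b.constr R fun x => Finsupp.linearCombination R fun m => act b χ m.card x m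

variable (R J) in
/-- The polynomials of degree at most `n`. -/
def deg (n : ℕ) : Submodule R (Multiset J →₀ R) := Finsupp.supported R R {m | m.card ≤ n}

theorem single_mem_deg {m : Multiset J} {n : ℕ} (h : m.card ≤ n) (r : R) :
    Finsupp.single m r ∈ deg R J n :=
  Finsupp.single_mem_supported R r h

theorem deg_mono {m n : ℕ} (h : m ≤ n) : deg R J m ≤ deg R J n :=
  Finsupp.supported_mono fun _ hx => le_trans hx h

theorem deg_induction {n : ℕ} {P : (Multiset J →₀ R) → Prop} (h0 : P 0)
    (hadd : ∀ v w, P v → P w → P (v + w)) (hsmul : ∀ (r : R) v, P v → P (r • v))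
    (hs : ∀ m : Multiset J, m.card ≤ n → P (Finsupp.single m 1)) {w : Multiset J →₀ R}
    (hw : w ∈ deg R J n) : P w := by
  rw [deg, Finsupp.supported_eq_span_single] at hw
  induction hw using Submodule.span_induction with
  | mem x hx => obtain ⟨m, hm, rfl⟩ := hx; exact hs m hm
  | zero => exact h0
  | add x y _ _ hx hy => exact hadd x y hx hy
  | smul r x _ hx => exact hsmul r x hx

theorem act_eq {n : ℕ} {m : Multiset J} (h : m.card ≤ n) (x : J ⊕ K) :
    act b χ n x m = act b χ m.card x m := by
  induction n with
  | zero => rw [Nat.le_zero.1 h]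
  | succ n ih =>
    by_cases hm : m.card ≤ n
    · rw [act, if_pos hm, ih hm]
    · rw [show m.card = n + 1 by lia]

theorem act_cons {j : J} {m : Multiset J} (hj : ∀ l ∈ m, j ≤ l) (x : J ⊕ K)
    [Decidable (∃ i, x = .inl i ∧ i ≤ j)] :
    act b χ (j ::ₘ m).card x (j ::ₘ m) =
      if ∃ i, x = .inl i ∧ i ≤ j then leading R x (j ::ₘ m) else
          leading R x (j ::ₘ m) +
            Finsupp.linearCombination R (act b χ m.card (.inl j))
              (act b χ m.card x m - leading R x m) +
            b.constr R (fun z => act b χ m.card z m) ⁅b x, b (.inl j)⁆ := by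
  rw [Multiset.card_cons, act, if_neg (by simp), Multiset.sort_cons _ _ _ hj]
  simp only [Multiset.sort_eq]

theorem exists_cons {m : Multiset J} (hm : m ≠ 0) :
    ∃ j m', m = j ::ₘ m' ∧ ∀ l ∈ m', j ≤ l := by
  obtain ⟨j, hj, h⟩ := m.toFinset.exists_min_image id (by simpa using hm)
  obtain ⟨m', rfl⟩ := Multiset.exists_cons_of_mem (Multiset.mem_toFinset.1 hj)
  exact ⟨j, m', rfl, fun l hl => h l (by simp [hl])⟩

theorem leading_mem (x : J ⊕ K) (m : Multiset J) : leading R x m ∈ deg R J (m.card + 1) := by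
  cases x with
  | inl i => exact single_mem_deg (by simp) _
  | inr k => exact Submodule.zero_mem _

theorem linearCombination_mem {f : Multiset J → (Multiset J →₀ R)} {n k : ℕ}
    (hf : ∀ m : Multiset J, m.card ≤ n → f m ∈ deg R J k) {w : Multiset J →₀ R}
    (hw : w ∈ deg R J n) : Finsupp.linearCombination R f w ∈ deg R J k := by
  refine deg_induction (P := fun w => Finsupp.linearCombination R f w ∈ deg R J k) ?_
    (fun v w hv hw => ?_) (fun r v hv => ?_) (fun m hm => ?_) hw
  · rw [map_zero]; exact Submodule.zero_mem _
  · rw [map_add]; exact Submodule.add_mem _ hv hw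
  · rw [map_smul]; exact Submodule.smul_mem _ _ hv
  · rw [Finsupp.linearCombination_single, one_smul]; exact hf m hm

theorem constr_mem {f : J ⊕ K → (Multiset J →₀ R)} {k : ℕ} (hf : ∀ x, f x ∈ deg R J k) (u : g) :
    b.constr R f u ∈ deg R J k := by
  rw [Module.Basis.constr_apply]
  exact Submodule.sum_mem _ fun i _ => Submodule.smul_mem _ _ (hf i)

/-- Both correction terms in the recursion are a basis vector or a bracket applied to something of
degree below that of `m`, and an action raises the degree by at most one. -/
theorem act_sub_leading_mem (n : ℕ) : ∀ (m : Multiset J), m.card ≤ n → ∀ x : J ⊕ K,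
    act b χ m.card x m - leading R x m ∈ deg R J m.card := by
  classical
  induction n with
  | zero =>
    intro m hm x
    obtain rfl : m = 0 := by simpa using hm
    cases x with
    | inl i => simp [act, leading]
    | inr k => simpa [act, leading] using single_mem_deg (by simp) _
  | succ n ih =>
    intro m hm x
    by_cases h0 : m = 0
    · exact ih m (by simp [h0]) x
    have hact : ∀ m : Multiset J, m.card ≤ n → ∀ x : J ⊕ K,
        act b χ m.card x m ∈ deg R J (m.card + 1) := fun m hm x => by
      have := Submodule.add_mem _ (deg_mono (Nat.le_succ _) (ih m hm x)) (leading_mem x m)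
      rwa [sub_add_cancel] at this
    obtain ⟨j, m, rfl, hj⟩ := exists_cons h0
    have hm' : m.card ≤ n := by simpa using hm
    rw [act_cons b χ hj]
    split_ifs
    · rw [sub_self]; exact Submodule.zero_mem _
    · rw [add_assoc, add_sub_cancel_left, Multiset.card_cons]
      refine Submodule.add_mem _ (linearCombination_mem (fun p hp => ?_) (ih m hm' x))
        (constr_mem b (fun z => hact m hm' z) _)
      rw [act_eq b χ hp]
      exact deg_mono (by lia) (hact p (hp.trans hm') _)

theorem op_basis_single (x : J ⊕ K) (m : Multiset J) :
    op b χ (b x) (Finsupp.single m 1) = act b χ m.card x m := by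
  rw [op, Module.Basis.constr_basis, Finsupp.linearCombination_single, one_smul]

theorem op_single (u : g) (m : Multiset J) :
    op b χ u (Finsupp.single m 1) = b.constr R (fun x => act b χ m.card x m) u := by
  have h : (op b χ).flip (Finsupp.single m 1) = b.constr R (fun x => act b χ m.card x m) :=
    b.ext fun x => by rw [LinearMap.flip_apply, op_basis_single, Module.Basis.constr_basis]
  exact LinearMap.congr_fun h u

theorem op_sub_leading_mem (x : J ⊕ K) (m : Multiset J) :
    op b χ (b x) (Finsupp.single m 1) - leading R x m ∈ deg R J m.card := by
  rw [op_basis_single]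
  exact act_sub_leading_mem b χ _ m le_rfl x

theorem op_inr_single (k : K) :
    op b χ (b (.inr k)) (Finsupp.single 0 1) = χ k • Finsupp.single 0 1 := by
  rw [op_basis_single, Finsupp.smul_single_one]
  rfl

theorem op_inl_single {i : J} {m : Multiset J} (hi : ∀ l ∈ m, i ≤ l) :
    op b χ (b (.inl i)) (Finsupp.single m 1) = Finsupp.single (i ::ₘ m) 1 := by
  classical
  rw [op_basis_single]
  by_cases h0 : m = 0
  · subst h0; rfl
  obtain ⟨j, m, rfl, hj⟩ := exists_cons h0
  rw [act_cons b χ hj, if_pos ⟨i, rfl, hi j (Multiset.mem_cons_self _ _)⟩]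
  rfl

theorem op_eq_on_deg {f f' : Module.End R (Multiset J →₀ R)} {n : ℕ}
    (h : ∀ m : Multiset J, m.card ≤ n → f (Finsupp.single m 1) = f' (Finsupp.single m 1))
    {w : Multiset J →₀ R} (hw : w ∈ deg R J n) : f w = f' w := by
  refine deg_induction (P := fun w => f w = f' w) ?_ (fun v w hv hw => ?_) (fun r v hv => ?_) h hw
  · simp
  · rw [map_add, map_add, hv, hw]
  · rw [map_smul, map_smul, hv]

/-- This is the recursive clause of `act` read back: since j is minimal, it multiplies the leading
term freely. -/
theorem op_comm_of_not_le {x : J ⊕ K} {j : J} {m : Multiset J} (hj : ∀ l ∈ m, j ≤ l)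
    (hx : ¬ ∃ i, x = .inl i ∧ i ≤ j) :
    op b χ (b x) (op b χ (b (.inl j)) (Finsupp.single m 1)) =
      op b χ (b (.inl j)) (op b χ (b x) (Finsupp.single m 1)) +
        op b χ ⁅b x, b (.inl j)⁆ (Finsupp.single m 1) := by
  classical
  have h1 : op b χ (b (.inl j)) (leading R x m) = leading R x (j ::ₘ m) := by
    cases x with
    | inl i =>
      have hij : j < i := by
        by_contra h
        exact hx ⟨i, rfl, not_lt.1 h⟩
      change op b χ (b (.inl j)) (Finsupp.single (i ::ₘ m) 1) = Finsupp.single (i ::ₘ j ::ₘ m) 1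
      rw [op_inl_single b χ, Multiset.cons_swap]
      intro l hl
      obtain rfl | hl := Multiset.mem_cons.1 hl
      exacts [hij.le, hj l hl]
    | inr k => exact map_zero _
  have h2 : Finsupp.linearCombination R (act b χ m.card (.inl j))
      (act b χ m.card x m - leading R x m) =
      op b χ (b (.inl j)) (act b χ m.card x m - leading R x m) := by
    refine op_eq_on_deg (f := Finsupp.linearCombination R (act b χ m.card (.inl j)))
      (fun p hp => ?_) (act_sub_leading_mem b χ _ m le_rfl x)
    rw [Finsupp.linearCombination_single, one_smul, op_basis_single, act_eq b χ hp]
  rw [op_inl_single b χ hj, op_basis_single, act_cons b χ hj, if_neg hx, h2, map_sub, h1,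
    op_single b χ ⁅_, _⁆, op_basis_single]
  abel

/-- The case not covered by the recursion is x = i < j. Then i is also minimal, so the previous
lemma applies with i and j exchanged, and the bracket changes sign. -/
theorem op_comm_basis {x : J ⊕ K} {j : J} {m : Multiset J} (hj : ∀ l ∈ m, j ≤ l) :
    op b χ (b x) (op b χ (b (.inl j)) (Finsupp.single m 1)) =
      op b χ (b (.inl j)) (op b χ (b x) (Finsupp.single m 1)) +
        op b χ ⁅b x, b (.inl j)⁆ (Finsupp.single m 1) := by
  by_cases hx : ∃ i, x = .inl i ∧ i ≤ j
  · obtain ⟨i, rfl, hij⟩ := hx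
    obtain rfl | hlt := hij.eq_or_lt
    · rw [lie_self, map_zero, LinearMap.zero_apply, add_zero]
    · have hi : ∀ l ∈ m, i ≤ l := fun l hl => hij.trans (hj l hl)
      have := op_comm_of_not_le b χ (x := .inl j) hi
        (by rintro ⟨_, h, h'⟩; cases h; exact absurd hlt (not_lt.2 h'))
      rw [this, add_assoc, ← LinearMap.add_apply, ← map_add, ← lie_skew, neg_add_cancel, map_zero,
        LinearMap.zero_apply, add_zero]
  · exact op_comm_of_not_le b χ hj hx

theorem basis_induction {ι M : Type*} [AddCommGroup M] [Module R M] (b : Module.Basis ι R M)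
    {P : M → Prop} (zero : P 0) (add : ∀ u v, P u → P v → P (u + v))
    (smul : ∀ (r : R) u, P u → P (r • u)) (coe : ∀ i, P (b i)) (u : M) : P u := by
  induction b.mem_span u using Submodule.span_induction with
  | mem x hx => obtain ⟨i, rfl⟩ := hx; exact coe i
  | zero => exact zero
  | add x y _ _ hx hy => exact add x y hx hy
  | smul r x _ hx => exact smul r x hx

theorem op_comm_inl (u : g) {j : J} {m : Multiset J} (hj : ∀ l ∈ m, j ≤ l) :
    op b χ u (op b χ (b (.inl j)) (Finsupp.single m 1)) =
      op b χ (b (.inl j)) (op b χ u (Finsupp.single m 1)) +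
        op b χ ⁅u, b (.inl j)⁆ (Finsupp.single m 1) := by
  induction u using basis_induction b with
  | zero => simp
  | add u v hu hv => simp only [map_add, LinearMap.add_apply, add_lie, hu, hv]; abel
  | smul r u hu => simp only [map_smul, LinearMap.smul_apply, smul_lie, hu, smul_add]
  | coe x => exact op_comm_basis b χ hj

/-- If `χ` extends to a character of the span of the vectors indexed by `K`, then `op` is a
representation. -/
theorem op_lie (hχ : ∀ k l : K, op b χ ⁅b (.inr k), b (.inr l)⁆ (Finsupp.single 0 1) = 0) (n : ℕ) :
    ∀ (w : Multiset J →₀ R), w ∈ deg R J n → ∀ u v : g,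
      op b χ u (op b χ v w) = op b χ v (op b χ u w) + op b χ ⁅u, v⁆ w := by
  have key : ∀ (m : Multiset J), (∀ x y : J ⊕ K,
      op b χ (b x) (op b χ (b y) (Finsupp.single m 1)) =
        op b χ (b y) (op b χ (b x) (Finsupp.single m 1)) +
          op b χ ⁅b x, b y⁆ (Finsupp.single m 1)) → ∀ u v : g,
      op b χ u (op b χ v (Finsupp.single m 1)) =
        op b χ v (op b χ u (Finsupp.single m 1)) + op b χ ⁅u, v⁆ (Finsupp.single m 1) := by
    intro m h u v
    induction v using basis_induction b with
    | zero => simp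
    | add v w hv hw => simp only [map_add, LinearMap.add_apply, lie_add, hv, hw]; abel
    | smul r v hv => simp only [map_smul, LinearMap.smul_apply, lie_smul, hv, smul_add]
    | coe y =>
      induction u using basis_induction b with
      | zero => simp
      | add v w hv hw => simp only [map_add, LinearMap.add_apply, add_lie, hv, hw]; abel
      | smul r v hv => simp only [map_smul, LinearMap.smul_apply, smul_lie, hv, smul_add]
      | coe x => exact h x y
  have hswap : ∀ {u v : g} {w : Multiset J →₀ R},
      op b χ u (op b χ v w) = op b χ v (op b χ u w) + op b χ ⁅u, v⁆ w →
      op b χ v (op b χ u w) = op b χ u (op b χ v w) + op b χ ⁅v, u⁆ w := by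
    intro u v w h
    rw [h, add_assoc, ← LinearMap.add_apply, ← map_add, ← lie_skew, neg_add_cancel, map_zero,
        LinearMap.zero_apply, add_zero]
  have hlin : ∀ {n : ℕ}, (∀ m : Multiset J, m.card ≤ n → ∀ u v : g,
      op b χ u (op b χ v (Finsupp.single m 1)) =
        op b χ v (op b χ u (Finsupp.single m 1)) + op b χ ⁅u, v⁆ (Finsupp.single m 1)) →
      ∀ (w : Multiset J →₀ R), w ∈ deg R J n → ∀ u v : g,
      op b χ u (op b χ v w) = op b χ v (op b χ u w) + op b χ ⁅u, v⁆ w := fun h w hw u v =>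
    op_eq_on_deg (f := op b χ u * op b χ v) (f' := op b χ v * op b χ u + op b χ ⁅u, v⁆)
      (fun m hm => h m hm u v) hw
  induction n with
  | zero =>
    refine hlin fun m hm => key m fun x y => ?_
    obtain rfl : m = 0 := by simpa using hm
    rcases y with j | l
    · exact op_comm_inl b χ _ (by simp)
    · rcases x with i | k
      · exact hswap (op_comm_inl b χ _ (by simp))
      -- Two vectors of `K` act on 1 by scalars, which commute, so their bracket has to kill 1; this
      -- is `hχ`.
      · rw [hχ, op_inr_single, op_inr_single, map_smul, map_smul, op_inr_single, op_inr_single,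
          smul_comm, add_zero]
  | succ n ih =>
    refine hlin fun m hm => ?_
    by_cases hm0 : m = 0
    · exact ih _ (single_mem_deg (by simp [hm0]) _)
    refine key m fun x y => ?_
    obtain ⟨j, m, rfl, hj⟩ := exists_cons hm0
    have hcons : ∀ i, i ≤ j → ∀ l ∈ j ::ₘ m, i ≤ l := by
      intro i hi l hl
      obtain rfl | hl := Multiset.mem_cons.1 hl
      exacts [hi, hi.trans (hj l hl)]
    by_cases hy : ∃ i, y = .inl i ∧ i ≤ j
    · obtain ⟨i, rfl, hi⟩ := hy
      exact op_comm_inl b χ _ (hcons i hi)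
    by_cases hx : ∃ i, x = .inl i ∧ i ≤ j
    · obtain ⟨i, rfl, hi⟩ := hx
      exact hswap (op_comm_inl b χ _ (hcons i hi))
    have hmn : m.card ≤ n := by simpa using hm
    have hm1 : Finsupp.single m (1 : R) ∈ deg R J n := single_mem_deg hmn _
    -- To move x past j on ym, split ym. The part of lower degree is covered by `ih`; the leading
    -- term is a monomial for which j is still minimal, or zero.
    have hzxy : ∀ (x y : J ⊕ K), ¬ (∃ i, y = .inl i ∧ i ≤ j) →
        op b χ (b x) (op b χ (b (.inl j)) (op b χ (b y) (Finsupp.single m 1))) =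
          op b χ (b (.inl j)) (op b χ (b x) (op b χ (b y) (Finsupp.single m 1))) +
          op b χ ⁅b x, b (.inl j)⁆ (op b χ (b y) (Finsupp.single m 1)) := by
      intro x y hy
      have h1 := ih _ (deg_mono hmn (op_sub_leading_mem b χ y m)) (b x) (b (.inl j))
      have h2 : op b χ (b x) (op b χ (b (.inl j)) (leading R y m)) =
          op b χ (b (.inl j)) (op b χ (b x) (leading R y m)) +
            op b χ ⁅b x, b (.inl j)⁆ (leading R y m) := by
        cases y with
        | inl i =>
          refine op_comm_inl b χ _ fun l hl => ?_
          obtain rfl | hl := Multiset.mem_cons.1 hl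
          · by_contra h
            exact hy ⟨l, rfl, (not_le.1 h).le⟩
          · exact hj l hl
        | inr k => simp [leading]
      simp only [map_sub] at h1
      rw [h2] at h1
      have h3 := congrArg (· + (op b χ (b (.inl j)) (op b χ (b x) (leading R y m)) +
            op b χ ⁅b x, b (.inl j)⁆ (leading R y m))) h1
      simp only [sub_add_cancel] at h3
      rw [h3]
      abel
    have e1 := hzxy x y hy
    have e2 := hzxy y x hx
    have e3 := ih _ hm1 (b x) ⁅b y, b (.inl j)⁆
    have e4 := ih _ hm1 (b y) ⁅b x, b (.inl j)⁆
    have e5 := ih _ hm1 (b x) (b y)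
    have e6 := op_comm_inl b χ ⁅b x, b y⁆ hj
    -- Once the monomial is written as j applied to `m` and everything is moved past j, the claim is
    -- the Jacobi identity for x, y and j.
    rw [← op_inl_single b χ hj, op_comm_inl b χ (b y) hj, op_comm_inl b χ (b x) hj, e6, map_add,
      map_add, e1, e2, e3, e4, e5, lie_lie (b x) (b y), map_add, map_sub, LinearMap.sub_apply]
    abel

theorem exists_mem_deg (w : Multiset J →₀ R) : ∃ n, w ∈ deg R J n :=
  ⟨w.support.sup Multiset.card, (Finsupp.mem_supported R w).2 fun _ hm =>
    Finset.le_sup (f := Multiset.card) hm⟩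

/-- The induced module, realized on polynomials. -/
abbrev lieRingModule
    (hχ : ∀ k l : K, op b χ ⁅b (.inr k), b (.inr l)⁆ (Finsupp.single 0 1) = 0) :
    LieRingModule g (Multiset J →₀ R) where
  bracket u w := op b χ u w
  add_lie u v w := by
    change op b χ (u + v) w = op b χ u w + op b χ v w
    rw [map_add, LinearMap.add_apply]
  lie_add u := map_add (op b χ u)
  leibniz_lie u v w := by
    obtain ⟨n, hn⟩ := exists_mem_deg w
    change op b χ u (op b χ v w) = op b χ ⁅u, v⁆ w + op b χ v (op b χ u w)
    rw [op_lie b χ hχ n w hn, add_comm]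

theorem lieModule
    (hχ : ∀ k l : K, op b χ ⁅b (.inr k), b (.inr l)⁆ (Finsupp.single 0 1) = 0) :
    letI := lieRingModule b χ hχ
    LieModule R g (Multiset J →₀ R) :=
  letI := lieRingModule b χ hχ
  { smul_lie := fun r u w => by
      change op b χ (r • u) w = r • op b χ u w
      rw [map_smul, LinearMap.smul_apply]
    lie_smul := fun r u w => map_smul (op b χ u) r w }

end InducedMonomials

/-! ### Kernels of lowering operators -/

namespace Lowering

variable {𝕜 V : Type*} [Field 𝕜] [AddCommGroup V] [Module 𝕜 V]

/-- The smallest subspace that contains `T` and is stable under the operators in `Y`. -/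
def closure (Y : Set (Module.End 𝕜 V)) (T : Submodule 𝕜 V) : Submodule 𝕜 V :=
  sInf {S | T ≤ S ∧ ∀ y ∈ Y, S ≤ S.comap y}

variable {Y : Set (Module.End 𝕜 V)} {T : Submodule 𝕜 V}

theorem le_closure : T ≤ closure Y T := le_sInf fun _ hS => hS.1

theorem apply_mem_closure {y : Module.End 𝕜 V} (hy : y ∈ Y) {v : V} (hv : v ∈ closure Y T) :
    y v ∈ closure Y T :=
  (Submodule.mem_sInf).2 fun S hS => hS.2 y hy ((Submodule.mem_sInf).1 hv S hS)

theorem closure_le {S : Submodule 𝕜 V} (h : T ≤ S) (hS : ∀ y ∈ Y, ∀ v ∈ S, y v ∈ S) :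
    closure Y T ≤ S :=
  sInf_le ⟨h, fun y hy v hv => hS y hy v hv⟩

theorem closure_mono {Y' : Set (Module.End 𝕜 V)} (h : Y ⊆ Y') : closure Y T ≤ closure Y' T :=
  closure_le le_closure fun _ hy _ hv => apply_mem_closure (h hy) hv

/-- An operator that preserves `T` and commutes with `Y` preserves the closure. -/
theorem apply_mem_closure_of_commute {z : Module.End 𝕜 V} (hT : ∀ t ∈ T, z t ∈ T)
    (hz : ∀ y ∈ Y, ∀ v, z (y v) = y (z v)) {v : V} (hv : v ∈ closure Y T) : z v ∈ closure Y T := by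
  have h : closure Y T ≤ closure Y T ⊓ (closure Y T).comap z :=
    closure_le (fun t ht => ⟨le_closure ht, le_closure (hT t ht)⟩) fun y hy v hv =>
      ⟨apply_mem_closure hy hv.1, by
        change z (y v) ∈ closure Y T
        rw [hz y hy]; exact apply_mem_closure hy hv.2⟩
  exact (h hv).2

/-- A family of operators that preserves `T` and is compatible with `Y` preserves the closure. -/
theorem family_apply_mem_closure {ι : Type*} {z : ι → Module.End 𝕜 V}
    (hT : ∀ i, ∀ t ∈ T, z i t ∈ closure Y T)
    (hz : ∀ y ∈ Y, ∀ v ∈ closure Y T, (∀ i, z i v ∈ closure Y T) → ∀ i, z i (y v) ∈ closure Y T)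
    (i : ι) {v : V} (hv : v ∈ closure Y T) : z i v ∈ closure Y T := by
  have h : closure Y T ≤ closure Y T ⊓ ⨅ i, (closure Y T).comap (z i) := by
    refine closure_le (fun t ht => ⟨le_closure ht, ?_⟩) fun y hy v hv =>
      ⟨apply_mem_closure hy hv.1, ?_⟩
    · exact (Submodule.mem_iInf _).2 fun i => hT i t ht
    · exact (Submodule.mem_iInf _).2 fun i =>
        hz y hy v hv.1 (fun i => (Submodule.mem_iInf _).1 hv.2 i) i
  exact (Submodule.mem_iInf _).1 (h hv).2 i

/-- `T + y T + ⋯ + y ^ n T`. -/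
def powers (y : Module.End 𝕜 V) (T : Submodule 𝕜 V) : ℕ → Submodule 𝕜 V
  | 0 => T
  | n + 1 => T ⊔ (powers y T n).map y

theorem powers_le_succ (y : Module.End 𝕜 V) (T : Submodule 𝕜 V) (n : ℕ) :
    powers y T n ≤ powers y T (n + 1) := by
  induction n with
  | zero => exact le_sup_left
  | succ n ih => exact sup_le_sup_left (Submodule.map_mono ih) _

theorem powers_mono (y : Module.End 𝕜 V) (T : Submodule 𝕜 V) : Monotone (powers y T) :=
  monotone_nat_of_le_succ (powers_le_succ y T)

/-- Moving x past one factor y costs the commutator, which commutes with y and preserves `T`, so no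
new power of y appears. The predicate `P` singles out the admissible commutators. -/
theorem apply_mem_powers {y x : Module.End 𝕜 V} {P : Module.End 𝕜 V → Prop}
    (hP : ∀ z, P z → ∀ t ∈ T, z t ∈ T) (hPy : ∀ z, P z → ∀ v, z (y v) = y (z v))
    (hx : ∀ t ∈ T, x t ∈ T) (hxy : P (x * y - y * x)) (n : ℕ) :
    ∀ v ∈ powers y T n, x v ∈ powers y T n := by
  have hz : ∀ (n : ℕ) (z), P z → ∀ v ∈ powers y T n, z v ∈ powers y T n := by
    intro n z hz
    induction n with
    | zero => exact hP z hz
    | succ n ih =>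
      intro v hv
      obtain ⟨t, ht, _, ⟨w, hw, rfl⟩, rfl⟩ := Submodule.mem_sup.1 hv
      rw [map_add, hPy z hz]
      exact Submodule.add_mem_sup (hP z hz t ht) ⟨_, ih w hw, rfl⟩
  induction n with
  | zero => exact hx
  | succ n ih =>
    intro v hv
    obtain ⟨t, ht, _, ⟨w, hw, rfl⟩, rfl⟩ := Submodule.mem_sup.1 hv
    have h : x (y w) = y (x w) + (x * y - y * x) w := by simp
    rw [map_add, h, ← add_assoc]
    exact Submodule.add_mem _ (Submodule.add_mem_sup (hx t ht) ⟨_, ih w hw, rfl⟩)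
      (powers_le_succ y T n (hz n _ hxy w hw))

/-- As for x and d/dx, the operator yD is multiplication by ck on y^k T. Hence yD - c(n+1) removes
the top layer y^{n+1} T, and when Dv = 0 this puts c(n+1)v, and so v, one layer lower. -/
theorem mem_of_mem_powers [CharZero 𝕜] {y D : Module.End 𝕜 V} {U : Submodule 𝕜 V} {c : 𝕜}
    (hc : c ≠ 0) (hTU : T ≤ U) (hyU : ∀ u ∈ U, y u ∈ U) (hDT : ∀ t ∈ T, D t = 0)
    (hDy : ∀ u ∈ U, D (y u) = y (D u) + c • u) {n : ℕ} {v : V} (hv : v ∈ powers y T n)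
    (hDv : D v = 0) : v ∈ T := by
  have hU : ∀ n, powers y T n ≤ U := by
    intro n
    induction n with
    | zero => exact hTU
    | succ n ih => exact sup_le hTU (Submodule.map_le_iff_le_comap.2 fun u hu => hyU u (ih hu))
  have key : ∀ n, ∀ v ∈ powers y T (n + 1),
      y (D v) - (c * (n + 1 : ℕ)) • v ∈ powers y T n := by
    intro n
    induction n with
    | zero =>
      intro v hv
      obtain ⟨t, ht, _, ⟨w, hw, rfl⟩, rfl⟩ := Submodule.mem_sup.1 hv
      rw [map_add, hDT t ht, hDy w (hU 0 hw), hDT w hw]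
      simpa [powers] using Submodule.smul_mem _ c ht
    | succ n ih =>
      intro v hv
      obtain ⟨t, ht, _, ⟨w, hw, rfl⟩, rfl⟩ := Submodule.mem_sup.1 hv
      rw [map_add, hDT t ht, hDy w (hU _ hw)]
      have h := ih w hw
      have e : y (0 + (y (D w) + c • w)) - (c * (n + 1 + 1 : ℕ)) • (t + y w) =
          -((c * (n + 1 + 1 : ℕ)) • t) + y (y (D w) - (c * (n + 1 : ℕ)) • w) := by
        push_cast
        simp only [map_add, map_sub, map_smul, zero_add, smul_add]
        module
      rw [e]
      exact Submodule.add_mem_sup (Submodule.neg_mem _ (Submodule.smul_mem _ _ ht)) ⟨_, h, rfl⟩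
  induction n with
  | zero => exact hv
  | succ n ih =>
    have h := key n v hv
    rw [hDv, map_zero, zero_sub, Submodule.neg_mem_iff,
      Submodule.smul_mem_iff _ (mul_ne_zero hc (Nat.cast_ne_zero.2 n.succ_ne_zero))] at h
    exact ih h

/-- If the lowering operators `D n` act on the closure of `T` under the raising operators `y n` in
a triangular way, then their common kernel is `T`. -/
theorem mem_of_forall_eq_zero [CharZero 𝕜] {y D : ℕ → Module.End 𝕜 V} {U : Submodule 𝕜 V}
    {c : ℕ → 𝕜}
    (hc : ∀ n, c n ≠ 0) (hTU : T ≤ U) (hyU : ∀ n, ∀ u ∈ U, y n u ∈ U)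
    (hyT : ∀ m n, ∀ t ∈ T, (y m * y n - y n * y m) t ∈ T)
    (hyy : ∀ m n k v, (y m * y n - y n * y m) (y k v) = y k ((y m * y n - y n * y m) v))
    (hDT : ∀ n, ∀ t ∈ T, D n t = 0)
    (hDlt : ∀ m n, m < n → ∀ u ∈ U, D n (y m u) = y m (D n u))
    (hDy : ∀ n, ∀ u ∈ U, D n (y n u) = y n (D n u) + c n • u) {v : V}
    (hv : v ∈ closure (Set.range y) T) (hDv : ∀ n, D n v = 0) : v ∈ T := by
  -- `S N` uses only the raising operators of index below N, so `D N` kills it. The step from `S (N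
  -- + 1)` to `S N` removes the powers of the single operator `y N`; nothing is needed about `D n`
  -- against `y m` with m > n.
  set S : ℕ → Submodule 𝕜 V := fun N => closure (y '' Set.Iio N) T with hS
  have hmono : Monotone S := fun m n h => closure_mono (Set.image_mono (Set.Iio_subset_Iio h))
  have hSU : ∀ n, S n ≤ U := fun n => closure_le hTU (by
    rintro _ ⟨m, -, rfl⟩
    exact hyU m)
  have hDS : ∀ n, ∀ u ∈ S n, D n u = 0 := by
    intro n u hu
    have h : S n ≤ U ⊓ LinearMap.ker (D n) := by
      refine closure_le (fun t ht => ⟨hTU ht, hDT n t ht⟩) ?_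
      rintro _ ⟨m, hm, rfl⟩ u ⟨hu, hu'⟩
      refine ⟨hyU m u hu, ?_⟩
      change D n u = 0 at hu'
      change D n (y m u) = 0
      rw [hDlt m n hm u hu, hu', map_zero]
    exact (h hu).2
  have hpow : ∀ n, ∀ u ∈ S (n + 1), ∃ k, u ∈ powers (y n) (S n) k := by
    intro n
    have h : S (n + 1) ≤ ⨆ k, powers (y n) (S n) k := by
      refine closure_le (le_closure.trans (le_iSup (powers (y n) (S n)) 0)) ?_
      rintro _ ⟨m, hm, rfl⟩ u hu
      rw [Submodule.mem_iSup_of_directed _ (powers_mono _ _).directed_le] at hu ⊢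
      obtain ⟨k, hk⟩ := hu
      rcases (Nat.lt_succ_iff.1 hm).eq_or_lt with rfl | hlt
      · exact ⟨k + 1, Submodule.mem_sup_right (Submodule.mem_map_of_mem hk)⟩
      · have hS' : ∀ t ∈ S n, y m t ∈ S n := fun t ht =>
          apply_mem_closure (Set.mem_image_of_mem y (Set.mem_Iio.2 hlt)) ht
        have hzS : ∀ z, (∃ m n, z = y m * y n - y n * y m) → ∀ t ∈ S n, z t ∈ S n := by
          rintro _ ⟨i, j, rfl⟩ t ht
          refine apply_mem_closure_of_commute (hyT i j) ?_ ht
          rintro _ ⟨l, -, rfl⟩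
          exact hyy i j l
        have hzy : ∀ z, (∃ m n, z = y m * y n - y n * y m) → ∀ v, z (y n v) = y n (z v) := by
          rintro _ ⟨i, j, rfl⟩
          exact hyy i j n
        -- The raising operators need not commute, but their commutators preserve `S n` and commute
        -- with `y n`, so the lower ones keep each layer of powers.
        exact ⟨k, apply_mem_powers hzS hzy hS' ⟨m, n, rfl⟩ k u hk⟩
    intro u hu
    exact (Submodule.mem_iSup_of_directed _ (powers_mono _ _).directed_le).1 (h hu)
  have hfin : ∃ N, v ∈ S N := by
    have h : closure (Set.range y) T ≤ ⨆ N, S N := by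
      refine closure_le (le_closure.trans (le_iSup S 0)) ?_
      rintro _ ⟨m, rfl⟩ u hu
      rw [Submodule.mem_iSup_of_directed _ hmono.directed_le] at hu ⊢
      obtain ⟨N, hN⟩ := hu
      exact ⟨max N (m + 1), apply_mem_closure (Y := y '' Set.Iio _) ⟨m, by simp, rfl⟩
        (hmono (le_max_left _ _) hN)⟩
    exact (Submodule.mem_iSup_of_directed _ hmono.directed_le).1 (h hv)
  obtain ⟨N, hN⟩ := hfin
  induction N with
  | zero =>
    refine closure_le le_rfl ?_ hN
    rintro _ ⟨m, hm, rfl⟩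
    exact absurd hm (Nat.not_lt_zero m)
  | succ n ih =>
    obtain ⟨k, hk⟩ := hpow n v hN
    exact ih (mem_of_mem_powers (hc n) (hSU n) (hyU n) (hDS n) (hDy n) hk (hDv n))

end Lowering

/-! ### Generators of the twisted algebra -/

namespace TwistedNW

open AffineNW

/-- `1 - (-1) ^ n`, which is `2` for odd `n` and `0` for even `n`. -/
def parity (n : ℤ) : ℂ := 1 - (-1) ^ n

theorem parity_even {n : ℤ} (h : Even n) : parity n = 0 := by
  rw [parity, h.neg_one_zpow, sub_self]

theorem parity_odd {n : ℤ} (h : Odd n) : parity n = 2 := by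
  rw [parity, h.neg_one_zpow]; norm_num

theorem neg_one_zpow_mul_parity (n : ℤ) : (-1 : ℂ) ^ n * parity n = -parity n := by
  rcases Int.even_or_odd n with h | h
  · rw [parity_even h]; simp
  · rw [h.neg_one_zpow]; simp

theorem τ_A (n : ℤ) : NappiWitten.τ (NappiWitten.mk 1 ((-1) ^ n) 0 0) =
    (-1 : ℂ) ^ n • NappiWitten.mk 1 ((-1) ^ n) 0 0 := by
  have h : (-1 : ℂ) ^ n * (-1) ^ n = 1 := by
    rw [← zpow_add₀ (by norm_num), Even.neg_one_zpow ⟨n, rfl⟩]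
  ext <;> simp [NappiWitten.τ_apply, h]

theorem τ_C (n : ℤ) : NappiWitten.τ (NappiWitten.mk 0 0 (parity n) 0) =
    (-1 : ℂ) ^ n • NappiWitten.mk 0 0 (parity n) 0 := by
  ext <;> simp [NappiWitten.τ_apply, neg_one_zpow_mul_parity]

theorem τ_D (n : ℤ) : NappiWitten.τ (NappiWitten.mk 0 0 0 (parity n)) =
    (-1 : ℂ) ^ n • NappiWitten.mk 0 0 0 (parity n) := by
  ext <;> simp [NappiWitten.τ_apply, neg_one_zpow_mul_parity]

/-- `(a + (-1)^n b)(n)`. -/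
def genA (n : ℤ) : TwistedNW := ⟨mode (NappiWitten.mk 1 ((-1) ^ n) 0 0) n, mode_mem (τ_A n)⟩

/-- `2 c(n)` for odd `n`, and `0` for even `n`. -/
def genC (n : ℤ) : TwistedNW := ⟨mode (NappiWitten.mk 0 0 (parity n) 0) n, mode_mem (τ_C n)⟩

/-- `2 d(n)` for odd `n`, and `0` for even `n`. -/
def genD (n : ℤ) : TwistedNW := ⟨mode (NappiWitten.mk 0 0 0 (parity n)) n, mode_mem (τ_D n)⟩

theorem mode_zero (n : ℤ) : mode 0 n = 0 := by
  have := mode_smul 0 0 n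
  rwa [zero_smul, zero_smul] at this

theorem genC_even {n : ℤ} (h : Even n) : genC n = 0 := by
  apply Subtype.ext
  change mode (NappiWitten.mk 0 0 (parity n) 0) n = 0
  rw [parity_even h, ← mode_zero n]
  congr 1
  ext <;> rfl

theorem genD_even {n : ℤ} (h : Even n) : genD n = 0 := by
  apply Subtype.ext
  change mode (NappiWitten.mk 0 0 0 (parity n)) n = 0
  rw [parity_even h, ← mode_zero n]
  congr 1
  ext <;> rfl

/-- The right side is the coefficient of c in [a + (-1)^m b, a + (-1)^n b]. -/
theorem parity_add (m n : ℤ) :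
    (-1 : ℂ) ^ n * parity (m + n) = (-1) ^ n - (-1) ^ m := by
  have h : (-1 : ℂ) ^ n * (-1) ^ n = 1 := by
    rw [← zpow_add₀ (by norm_num), Even.neg_one_zpow ⟨n, rfl⟩]
  rw [parity, zpow_add₀ (by norm_num)]
  linear_combination (-(-1 : ℂ) ^ m) * h

theorem lie_A_A (m n : ℤ) : ⁅genA m, genA n⁆ =
    (-1 : ℂ) ^ n • genC (m + n) + (if m + n = 0 then 2 * m * (-1 : ℂ) ^ n else 0) • k := by
  apply Subtype.ext
  change ⁅mode _ m, mode _ n⁆ = (-1 : ℂ) ^ n • mode _ (m + n) + _ • AffineNW.k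
  rw [lie_mode_mode, ← mode_smul]
  congr 2
  · ext <;> simp [NappiWitten.lie_def, parity_add]
  · split_ifs with h
    · have : (-1 : ℂ) ^ n = (-1) ^ m := by
        rw [← sub_eq_zero, ← parity_add, h, parity_even Even.zero, mul_zero]
      simp [NappiWitten.form_apply, this]
      ring
    · rfl

theorem lie_A_C (m n : ℤ) : ⁅genA m, genC n⁆ = 0 := by
  apply Subtype.ext
  change ⁅mode _ m, mode _ n⁆ = 0
  rw [lie_mode_mode, ← mode_zero (m + n), ← add_zero (mode 0 (m + n))]
  congr 2
  · ext <;> simp [NappiWitten.lie_def]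
  · simp [NappiWitten.form_apply]

theorem lie_C_C (m n : ℤ) : ⁅genC m, genC n⁆ = 0 := by
  apply Subtype.ext
  change ⁅mode _ m, mode _ n⁆ = 0
  rw [lie_mode_mode, ← mode_zero (m + n), ← add_zero (mode 0 (m + n))]
  congr 2
  · ext <;> simp [NappiWitten.lie_def]
  · simp [NappiWitten.form_apply]

theorem lie_D_D (m n : ℤ) : ⁅genD m, genD n⁆ = 0 := by
  apply Subtype.ext
  change ⁅mode _ m, mode _ n⁆ = 0
  rw [lie_mode_mode, ← mode_zero (m + n), ← add_zero (mode 0 (m + n))]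
  congr 2
  · ext <;> simp [NappiWitten.lie_def]
  · simp [NappiWitten.form_apply]

theorem lie_D_A (m n : ℤ) : ⁅genD m, genA n⁆ = parity m • genA (m + n) := by
  apply Subtype.ext
  change ⁅mode _ m, mode _ n⁆ = parity m • mode _ (m + n)
  rw [lie_mode_mode, ← mode_smul, ← add_zero (mode (parity m • _) (m + n))]
  congr 2
  · ext <;> simp [NappiWitten.lie_def]
    rw [zpow_add₀ (by norm_num)]
    linear_combination (-(-1 : ℂ) ^ n) * neg_one_zpow_mul_parity m
  · simp [NappiWitten.form_apply]

theorem lie_D_C (m n : ℤ) : ⁅genD m, genC n⁆ =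
    (if m + n = 0 then (m : ℂ) * (parity m * parity n) else 0) • k := by
  apply Subtype.ext
  change ⁅mode _ m, mode _ n⁆ = _ • AffineNW.k
  have h : ⁅NappiWitten.mk 0 0 0 (parity m), NappiWitten.mk 0 0 (parity n) 0⁆ = 0 := by
    ext <;> simp [NappiWitten.lie_def]
  rw [lie_mode_mode, h, mode_zero, zero_add]
  simp [NappiWitten.form_apply]

/-- The spanning set of the twisted algebra. -/
inductive IsGenerator : TwistedNW → Prop
  | A (n : ℤ) : IsGenerator (genA n)
  | C (n : ℤ) : IsGenerator (genC n)
  | D (n : ℤ) : IsGenerator (genD n)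
  | k : IsGenerator k

/-- Symmetrizing allows an induction over the untwisted algebra, whose modes are not themselves
fixed by `τHat`. On a fixed vector the symmetrization is twice the vector. -/
theorem exists_symmetrization (u : AffineNW) : ∃ v ∈ Submodule.span ℂ {u | IsGenerator u},
    (v : AffineNW) = u + τHat u := by
  induction u using AffineNW.induction with
  | h_add u v hu hv =>
    obtain ⟨u', hu', e1⟩ := hu
    obtain ⟨v', hv', e2⟩ := hv
    refine ⟨u' + v', Submodule.add_mem _ hu' hv', ?_⟩
    change (u' : AffineNW) + v' = _
    rw [e1, e2, map_add]
    abel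
  | h_k r =>
    refine ⟨(2 * r) • k, Submodule.smul_mem _ _ (Submodule.subset_span .k), ?_⟩
    change (2 * r) • AffineNW.k = _
    rw [map_smul, τHat_k, two_mul, add_smul]
  | h_mode x n =>
    refine ⟨(x 0 + (-1) ^ n * x 1) • genA n + ((x 2) • genC n + (x 3) • genD n),
      Submodule.add_mem _ (Submodule.smul_mem _ _ (Submodule.subset_span (.A n)))
        (Submodule.add_mem _ (Submodule.smul_mem _ _ (Submodule.subset_span (.C n)))
          (Submodule.smul_mem _ _ (Submodule.subset_span (.D n)))), ?_⟩
    have h : (-1 : ℂ) ^ n * (-1) ^ n = 1 := by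
      rw [← zpow_add₀ (by norm_num), Even.neg_one_zpow ⟨n, rfl⟩]
    change (x 0 + (-1) ^ n * x 1) • mode _ n + ((x 2) • mode _ n + (x 3) • mode _ n) = _
    rw [τHat_mode, ← mode_smul, ← mode_smul, ← mode_smul, ← mode_smul, ← mode_add, ← mode_add,
      ← mode_add]
    congr 1
    ext <;> simp [NappiWitten.τ_apply, parity]
    · linear_combination x 1 * h
    · ring
    · ring

theorem span_generators : Submodule.span ℂ {u | IsGenerator u} = ⊤ := by
  refine (Submodule.eq_top_iff').2 fun u => ?_
  obtain ⟨v, hv, e⟩ := exists_symmetrization (u : AffineNW)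
  have hu : τHat (u : AffineNW) = u := u.2
  have h : v = (2 : ℂ) • u := by
    apply Subtype.ext
    change (v : AffineNW) = (2 : ℂ) • (u : AffineNW)
    rw [e, hu, two_smul]
  rw [h] at hv
  exact (Submodule.smul_mem_iff _ two_ne_zero).1 hv

theorem generator_induction {P : TwistedNW → Prop} (zero : P 0)
    (add : ∀ u v, P u → P v → P (u + v)) (smul : ∀ (r : ℂ) u, P u → P (r • u))
    (gen : ∀ u, IsGenerator u → P u) (u : TwistedNW) : P u := by
  have h : u ∈ Submodule.span ℂ {u | IsGenerator u} := by rw [span_generators]; trivial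
  induction h using Submodule.span_induction with
  | mem x hx => exact gen x hx
  | zero => exact zero
  | add x y _ _ hx hy => exact add x y hx hy
  | smul r x _ hx => exact smul r x hx

/-- Positive modes in terms of the generators. -/
inductive IsPositiveGenerator : TwistedNW → Prop
  | A (n : ℤ) (hn : 0 < n) : IsPositiveGenerator (genA n)
  | C (n : ℤ) (hn : 0 < n) : IsPositiveGenerator (genC n)
  | D (n : ℤ) (hn : 0 < n) : IsPositiveGenerator (genD n)

theorem IsPositiveGenerator.mem {u : TwistedNW} (h : IsPositiveGenerator u) : u ∈ positive := by
  cases h with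
  | A n hn => exact mode_mem_span hn (τ_A n)
  | C n hn => exact mode_mem_span hn (τ_C n)
  | D n hn => exact mode_mem_span hn (τ_D n)

theorem span_positiveGenerators :
    Submodule.span ℂ {u | IsPositiveGenerator u} = Submodule.span ℂ positiveModes := by
  apply le_antisymm
  · exact Submodule.span_le.2 fun u hu => IsPositiveGenerator.mem hu
  · refine Submodule.span_le.2 fun u hu => ?_
    obtain ⟨n, hn, ⟨he, h⟩ | ⟨ho, h | h | h⟩⟩ := hu
    · have : u = genA n := by
        apply Subtype.ext
        change (u : AffineNW) = mode _ n
        rw [h, he.neg_one_zpow]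
        congr 1
        ext <;> simp [NappiWitten.a, NappiWitten.b]
      exact this ▸ Submodule.subset_span (.A n hn)
    · have : u = genA n := by
        apply Subtype.ext
        change (u : AffineNW) = mode _ n
        rw [h, ho.neg_one_zpow]
        congr 1
        ext <;> simp [NappiWitten.a, NappiWitten.b]
      exact this ▸ Submodule.subset_span (.A n hn)
    · have : (2⁻¹ : ℂ) • genC n = u := by
        apply Subtype.ext
        change (2⁻¹ : ℂ) • mode _ n = (u : AffineNW)
        rw [h, ← mode_smul, parity_odd ho]
        congr 1
        ext <;> simp [NappiWitten.c]
      exact this ▸ Submodule.smul_mem _ _ (Submodule.subset_span (.C n hn))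
    · have : (2⁻¹ : ℂ) • genD n = u := by
        apply Subtype.ext
        change (2⁻¹ : ℂ) • mode _ n = (u : AffineNW)
        rw [h, ← mode_smul, parity_odd ho]
        congr 1
        ext <;> simp [NappiWitten.d]
      exact this ▸ Submodule.smul_mem _ _ (Submodule.subset_span (.D n hn))

end TwistedNW

/-! ### Whittaker modules of nonzero level -/

namespace TwistedNW

variable {V : Type*} [AddCommGroup V] [Module ℂ V] [LieRingModule TwistedNW V]
  [LieModule ℂ TwistedNW V]

/-! ### Local nilpotency of the operators u - f(u) -/

section Filtration

variable (V) in
/-- The vectors killed by products of `n` operators `u - f u`, where `u` is positive. -/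
def whittakerFiltration (f : TwistedNW →ₗ[ℂ] ℂ) : ℕ → Submodule ℂ V
  | 0 => ⊥
  | n + 1 => ⨅ u : positive, (whittakerFiltration f n).comap
      (LieModule.toEnd ℂ TwistedNW V u - f u • (1 : Module.End ℂ V))

variable {f : TwistedNW →ₗ[ℂ] ℂ}

theorem mem_whittakerFiltration_succ {n : ℕ} {v : V} : v ∈ whittakerFiltration V f (n + 1) ↔
    ∀ u ∈ positive, ⁅u, v⁆ - f u • v ∈ whittakerFiltration V f n := by
  rw [whittakerFiltration, Submodule.mem_iInf]
  exact ⟨fun h u hu => h ⟨u, hu⟩, fun h u => h u u.2⟩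

theorem whittakerFiltration_mono : Monotone (whittakerFiltration V f) := by
  refine monotone_nat_of_le_succ fun n => ?_
  induction n with
  | zero => exact bot_le
  | succ n ih =>
    intro v hv
    rw [mem_whittakerFiltration_succ] at hv ⊢
    exact fun u hu => ih (hv u hu)

variable (V f) in
/-- The elements of the Lie algebra that raise the filtration degree by at most `r`. -/
def raising (r : ℕ) : Submodule ℂ TwistedNW where
  carrier := {y | ∀ i, ∀ v ∈ whittakerFiltration V f i, ⁅y, v⁆ ∈ whittakerFiltration V f (i + r)}
  add_mem' hx hy i v hv := by
    rw [add_lie]; exact Submodule.add_mem _ (hx i v hv) (hy i v hv)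
  zero_mem' i v _ := by rw [zero_lie]; exact Submodule.zero_mem _
  smul_mem' c x hx i v hv := by
    rw [smul_lie]; exact Submodule.smul_mem _ _ (hx i v hv)

theorem raising_mono {r s : ℕ} (h : r ≤ s) : raising V f r ≤ raising V f s :=
  fun _ hy i v hv => whittakerFiltration_mono (by lia) (hy i v hv)

theorem mem_raising_zero {u : TwistedNW} (hu : u ∈ positive) : u ∈ raising V f 0 := by
  intro i v hv
  have h := mem_whittakerFiltration_succ.1 (whittakerFiltration_mono (Nat.le_succ i) hv) u hu
  have := Submodule.add_mem _ h (Submodule.smul_mem _ (f u) hv)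
  rwa [sub_add_cancel] at this

/-- Follows from (u - f(u))y = y(u - f(u)) + [u, y] by induction on the filtration degree of the
vector. -/
theorem mem_raising_succ {y : TwistedNW} {r : ℕ}
    (h : ∀ u, IsPositiveGenerator u → ⁅u, y⁆ ∈ raising V f r) : y ∈ raising V f (r + 1) := by
  have h' : ∀ u ∈ positive, ⁅u, y⁆ ∈ raising V f r := by
    intro u hu
    change u ∈ Submodule.span ℂ positiveModes at hu
    rw [← span_positiveGenerators] at hu
    induction hu using Submodule.span_induction with
    | mem u hu => exact h u hu
    | zero => rw [zero_lie]; exact Submodule.zero_mem _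
    | add u v _ _ hu hv => rw [add_lie]; exact Submodule.add_mem _ hu hv
    | smul c u _ hu => rw [smul_lie]; exact Submodule.smul_mem _ _ hu
  intro i
  induction i with
  | zero =>
    intro v hv
    rw [(Submodule.mem_bot ℂ).1 hv, lie_zero]
    exact Submodule.zero_mem _
  | succ i ih =>
    intro v hv
    rw [show i + 1 + (r + 1) = i + (r + 1) + 1 by lia, mem_whittakerFiltration_succ]
    intro u hu
    have e : ⁅u, ⁅y, v⁆⁆ - f u • ⁅y, v⁆ = ⁅y, ⁅u, v⁆ - f u • v⁆ + ⁅⁅u, y⁆, v⁆ := by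
      rw [leibniz_lie, lie_sub, lie_smul]; abel
    rw [e]
    refine Submodule.add_mem _ (ih _ (mem_whittakerFiltration_succ.1 hv u hu)) ?_
    rw [show i + (r + 1) = i + 1 + r by lia]
    exact h' u hu _ v hv

/-- A bracket with a positive mode raises the index by at least one, up to a multiple of `k`. So 1 -
n brackets bring a mode of index n ≤ 0 into the positive part, which preserves the filtration. -/
theorem gen_mem_raising (hk : k ∈ raising V f 0) (r : ℕ) : ∀ n : ℤ, 1 - r ≤ n →
    genA n ∈ raising V f r ∧ genC n ∈ raising V f r ∧ genD n ∈ raising V f r := by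
  have hk' : ∀ (r : ℕ) (c : ℂ), c • k ∈ raising V f r := fun r c =>
    Submodule.smul_mem _ _ (raising_mono (Nat.zero_le r) hk)
  have hlie : ∀ {u v : TwistedNW} {r : ℕ}, ⁅u, v⁆ ∈ raising V f r → ⁅v, u⁆ ∈ raising V f r :=
    fun h => by rw [← lie_skew]; exact Submodule.neg_mem _ h
  induction r with
  | zero =>
    intro n hn
    have hn' : 0 < n := by push_cast at hn; lia
    exact ⟨mem_raising_zero (IsPositiveGenerator.A n hn').mem,
      mem_raising_zero (IsPositiveGenerator.C n hn').mem,
      mem_raising_zero (IsPositiveGenerator.D n hn').mem⟩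
  | succ r ih =>
    intro n hn
    push_cast at hn
    refine ⟨mem_raising_succ fun u hu => ?_, mem_raising_succ fun u hu => ?_,
      mem_raising_succ fun u hu => ?_⟩
    · cases hu with
      | A m hm =>
        rw [lie_A_A]
        exact Submodule.add_mem _ (Submodule.smul_mem _ _ (ih (m + n) (by lia)).2.1) (hk' _ _)
      | C m hm => exact hlie (by rw [lie_A_C]; exact Submodule.zero_mem _)
      | D m hm => rw [lie_D_A]; exact Submodule.smul_mem _ _ (ih (m + n) (by lia)).1
    · cases hu with
      | A m hm => rw [lie_A_C]; exact Submodule.zero_mem _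
      | C m hm => rw [lie_C_C]; exact Submodule.zero_mem _
      | D m hm => rw [lie_D_C]; exact hk' _ _
    · cases hu with
      | A m hm =>
        exact hlie (by rw [lie_D_A]; exact Submodule.smul_mem _ _ (ih (n + m) (by lia)).1)
      | C m hm => exact hlie (by rw [lie_D_C]; exact hk' _ _)
      | D m hm => rw [lie_D_D]; exact Submodule.zero_mem _

theorem eq_top_of_generator_mem {ω : V} (hgen : LieSubmodule.lieSpan ℂ TwistedNW {ω} = ⊤)
    {S : Submodule ℂ V} (hω : ω ∈ S) (hS : ∀ u, IsGenerator u → ∀ v ∈ S, ⁅u, v⁆ ∈ S) (v : V) :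
    v ∈ S := by
  have h : LieSubmodule.lieSpan ℂ TwistedNW {ω} ≤ { S with
      lie_mem := fun {u v} hv => by
        induction u using generator_induction with
        | zero => rw [zero_lie]; exact Submodule.zero_mem S
        | add x y hx hy => rw [add_lie]; exact Submodule.add_mem S hx hy
        | smul c x hx => rw [smul_lie]; exact Submodule.smul_mem S c hx
        | gen x hx => exact hS x hx v hv } :=
    LieSubmodule.lieSpan_le.2 (Set.singleton_subset_iff.2 hω)
  rw [hgen] at h
  exact h (LieSubmodule.mem_top v)

theorem exists_mem_whittakerFiltration {ξ : ℂ} (hk : ∀ v : V, ⁅k, v⁆ = ξ • v) {ω : V}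
    (hω : ∀ u ∈ positive, ⁅u, ω⁆ = f u • ω)
    (hgen : LieSubmodule.lieSpan ℂ TwistedNW {ω} = ⊤) (v : V) :
    ∃ n, v ∈ whittakerFiltration V f n := by
  have hdir := (whittakerFiltration_mono (V := V) (f := f)).directed_le
  rw [← Submodule.mem_iSup_of_directed _ hdir]
  have hk0 : k ∈ raising V f 0 := fun i v hv => by
    rw [hk]; exact Submodule.smul_mem _ _ hv
  refine eq_top_of_generator_mem hgen ?_ ?_ v
  · refine (Submodule.mem_iSup_of_directed _ hdir).2 ⟨1, mem_whittakerFiltration_succ.2 ?_⟩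
    intro u hu
    rw [hω u hu, sub_self]
    exact Submodule.zero_mem _
  · intro u hu v hv
    have hr : ∃ r, u ∈ raising V f r := by
      cases hu with
      | A n => exact ⟨(1 - n).toNat, (gen_mem_raising hk0 _ n (by lia)).1⟩
      | C n => exact ⟨(1 - n).toNat, (gen_mem_raising hk0 _ n (by lia)).2.1⟩
      | D n => exact ⟨(1 - n).toNat, (gen_mem_raising hk0 _ n (by lia)).2.2⟩
      | k => exact ⟨0, hk0⟩
    obtain ⟨r, hr⟩ := hr
    obtain ⟨i, hi⟩ := (Submodule.mem_iSup_of_directed _ hdir).1 hv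
    exact (Submodule.mem_iSup_of_directed _ hdir).2 ⟨i + r, hr i v hi⟩

end Filtration

/-! ### Spanning monomials, Whittaker vectors and irreducibility -/

section WhittakerVectors

open Lowering

local notation "ρ" => LieModule.toEnd ℂ TwistedNW V

theorem lie_lie_swap (x y : TwistedNW) (v : V) : ⁅x, ⁅y, v⁆⁆ = ⁅y, ⁅x, v⁆⁆ + ⁅⁅x, y⁆, v⁆ := by
  rw [leibniz_lie, add_comm]

theorem lie_C_A (m n : ℤ) : ⁅genC m, genA n⁆ = 0 := by
  rw [← lie_skew, lie_A_C, neg_zero]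

theorem C_A_apply (m n : ℤ) (v : V) : ⁅genC m, ⁅genA n, v⁆⁆ = ⁅genA n, ⁅genC m, v⁆⁆ := by
  rw [lie_lie_swap, lie_C_A, zero_lie, add_zero]

theorem C_C_apply (m n : ℤ) (v : V) : ⁅genC m, ⁅genC n, v⁆⁆ = ⁅genC n, ⁅genC m, v⁆⁆ := by
  rw [lie_lie_swap, lie_C_C, zero_lie, add_zero]

theorem D_D_apply (m n : ℤ) (v : V) : ⁅genD m, ⁅genD n, v⁆⁆ = ⁅genD n, ⁅genD m, v⁆⁆ := by
  rw [lie_lie_swap, lie_D_D, zero_lie, add_zero]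

theorem A_A_apply (m n : ℤ) (v : V) : ⁅genA m, ⁅genA n, v⁆⁆ = ⁅genA n, ⁅genA m, v⁆⁆ +
    ((-1 : ℂ) ^ n • ⁅genC (m + n), v⁆ +
      (if m + n = 0 then 2 * m * (-1 : ℂ) ^ n else 0) • ⁅(k : TwistedNW), v⁆) := by
  rw [lie_lie_swap, lie_A_A, add_lie, smul_lie, smul_lie]

theorem D_A_apply (m n : ℤ) (v : V) : ⁅genD m, ⁅genA n, v⁆⁆ = ⁅genA n, ⁅genD m, v⁆⁆ +
    parity m • ⁅genA (m + n), v⁆ := by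
  rw [lie_lie_swap, lie_D_A, smul_lie]

theorem D_C_apply (m n : ℤ) (v : V) : ⁅genD m, ⁅genC n, v⁆⁆ = ⁅genC n, ⁅genD m, v⁆⁆ +
    (if m + n = 0 then (m : ℂ) * (parity m * parity n) else 0) • ⁅(k : TwistedNW), v⁆ := by
  rw [lie_lie_swap, lie_D_C, smul_lie]

variable (V) in
/-- The operator `u - f u`. -/
def lower (f : TwistedNW →ₗ[ℂ] ℂ) (u : TwistedNW) : Module.End ℂ V :=
  ρ u - f u • (1 : Module.End ℂ V)

theorem lower_apply (f : TwistedNW →ₗ[ℂ] ℂ) (u : TwistedNW) (v : V) :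
    lower V f u v = ⁅u, v⁆ - f u • v := rfl

variable (V) in
/-- Multiplication by `c(-1), c(-3), …`. -/
def raiseC (n : ℕ) : Module.End ℂ V := ρ (genC (-(2 * n + 1)))

variable (V) in
/-- Multiplication by `(a + b)(0), (a - b)(-1), (a + b)(-2), …`. -/
def raiseA (n : ℕ) : Module.End ℂ V := ρ (genA (-n))

variable (V) in
/-- Multiplication by `d(-1), d(-3), …`. -/
def raiseD (n : ℕ) : Module.End ℂ V := ρ (genD (-(2 * n + 1)))

theorem raiseC_apply (n : ℕ) (v : V) : raiseC V n v = ⁅genC (-(2 * n + 1)), v⁆ := rfl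

theorem raiseA_apply (n : ℕ) (v : V) : raiseA V n v = ⁅genA (-n), v⁆ := rfl

theorem raiseD_apply (n : ℕ) (v : V) : raiseD V n v = ⁅genD (-(2 * n + 1)), v⁆ := rfl

/-- The span of the monomials in the `c(-n)` applied to `ω`. -/
def spanC (ω : V) : Submodule ℂ V := closure (Set.range (raiseC V)) (ℂ ∙ ω)

/-- The span of the monomials in the `c(-n)` and `(a ± b)(-n)` applied to `ω`. -/
def spanCA (ω : V) : Submodule ℂ V := closure (Set.range (raiseA V)) (spanC ω)

/-- The span of the monomials in the negative modes applied to `ω`. -/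
def spanCAD (ω : V) : Submodule ℂ V := closure (Set.range (raiseD V)) (spanCA ω)

variable (V) in
/-- The vectors on which the `c(n)` with `n > 0` act through `f`. -/
def eigenC (f : TwistedNW →ₗ[ℂ] ℂ) : Submodule ℂ V where
  carrier := {v | ∀ n : ℤ, 0 < n → ⁅genC n, v⁆ = f (genC n) • v}
  add_mem' hv hw n hn := by rw [lie_add, hv n hn, hw n hn, smul_add]
  zero_mem' n _ := by rw [lie_zero, smul_zero]
  smul_mem' c v hv n hn := by rw [lie_smul, hv n hn, smul_comm]

variable {f : TwistedNW →ₗ[ℂ] ℂ} {ξ : ℂ} {ω : V}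

theorem genC_mem_eigenC (m : ℤ) {v : V} (hv : v ∈ eigenC V f) : ⁅genC m, v⁆ ∈ eigenC V f :=
  fun n hn => by rw [C_C_apply, hv n hn, lie_smul]

theorem genA_mem_eigenC (m : ℤ) {v : V} (hv : v ∈ eigenC V f) : ⁅genA m, v⁆ ∈ eigenC V f :=
  fun n hn => by rw [C_A_apply, hv n hn, lie_smul]

theorem spanC_le_eigenC (hω : ∀ u ∈ positive, ⁅u, ω⁆ = f u • ω) : spanC ω ≤ eigenC V f := by
  refine closure_le ((Submodule.span_singleton_le_iff_mem _ _).2 fun n hn =>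
    hω _ (IsPositiveGenerator.C n hn).mem) ?_
  rintro _ ⟨n, rfl⟩ v hv
  exact genC_mem_eigenC _ hv

theorem spanCA_le_eigenC (hω : ∀ u ∈ positive, ⁅u, ω⁆ = f u • ω) : spanCA ω ≤ eigenC V f := by
  refine closure_le (spanC_le_eigenC hω) ?_
  rintro _ ⟨n, rfl⟩ v hv
  exact genA_mem_eigenC _ hv

theorem genC_mem_spanC (hω : ∀ u ∈ positive, ⁅u, ω⁆ = f u • ω) (n : ℤ) {v : V}
    (hv : v ∈ spanC ω) : ⁅genC n, v⁆ ∈ spanC ω := by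
  rcases lt_or_ge 0 n with hn | hn
  · rw [spanC_le_eigenC hω hv n hn]
    exact Submodule.smul_mem _ _ hv
  rcases Int.even_or_odd n with he | ⟨j, hj⟩
  · rw [genC_even he, zero_lie]
    exact Submodule.zero_mem _
  · obtain rfl : n = -(2 * ((-j - 1).toNat : ℤ) + 1) := by lia
    exact apply_mem_closure (Set.mem_range_self _) hv

theorem genC_mem_spanCA (hω : ∀ u ∈ positive, ⁅u, ω⁆ = f u • ω) (n : ℤ) {v : V}
    (hv : v ∈ spanCA ω) : ⁅genC n, v⁆ ∈ spanCA ω := by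
  refine apply_mem_closure_of_commute (z := ρ (genC n)) (fun t ht => genC_mem_spanC hω n ht) ?_ hv
  rintro _ ⟨m, rfl⟩ v
  exact C_A_apply _ _ _

theorem genA_apply_spanC (hω : ∀ u ∈ positive, ⁅u, ω⁆ = f u • ω) {n : ℤ} (hn : 0 < n) {v : V}
    (hv : v ∈ spanC ω) : ⁅genA n, v⁆ = f (genA n) • v := by
  have h : spanC ω ≤ LinearMap.ker (ρ (genA n) - f (genA n) • (1 : Module.End ℂ V)) := by
    refine closure_le ((Submodule.span_singleton_le_iff_mem _ _).2 ?_) ?_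
    · exact sub_eq_zero.2 (hω _ (IsPositiveGenerator.A n hn).mem)
    · rintro _ ⟨m, rfl⟩ v hv
      have hv' : ⁅genA n, v⁆ = f (genA n) • v := sub_eq_zero.1 hv
      change ⁅genA n, ⁅genC _, v⁆⁆ - f (genA n) • ⁅genC _, v⁆ = 0
      rw [← C_A_apply, hv', lie_smul, sub_self]
  exact sub_eq_zero.1 (h hv)

theorem genA_mem_spanCA (hk : ∀ v : V, ⁅k, v⁆ = ξ • v) (hω : ∀ u ∈ positive, ⁅u, ω⁆ = f u • ω)
    (n : ℤ) {v : V} (hv : v ∈ spanCA ω) : ⁅genA n, v⁆ ∈ spanCA ω := by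
  refine family_apply_mem_closure (z := fun n => ρ (genA n)) (fun n t ht => ?_) ?_ n hv
  · rcases lt_or_ge 0 n with hn | hn
    · have h := Submodule.smul_mem _ (f (genA n)) (le_closure (Y := Set.range (raiseA V)) ht)
      rwa [← genA_apply_spanC hω hn ht] at h
    · obtain ⟨j, rfl⟩ : ∃ j : ℕ, n = -j := ⟨(-n).toNat, by lia⟩
      exact apply_mem_closure (Set.mem_range_self j) (le_closure ht)
  · rintro _ ⟨m, rfl⟩ v hv ih n
    change ⁅genA n, ⁅genA _, v⁆⁆ ∈ spanCA ω
    rw [A_A_apply, hk]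
    exact Submodule.add_mem _ (apply_mem_closure (Set.mem_range_self m) (ih n))
      (Submodule.add_mem _ (Submodule.smul_mem _ _ (genC_mem_spanCA hω _ hv))
        (Submodule.smul_mem _ _ (Submodule.smul_mem _ _ hv)))

theorem genD_mem_spanC (hk : ∀ v : V, ⁅k, v⁆ = ξ • v) (hω : ∀ u ∈ positive, ⁅u, ω⁆ = f u • ω)
    {n : ℤ} (hn : 0 < n) {v : V} (hv : v ∈ spanC ω) : ⁅genD n, v⁆ ∈ spanC ω := by
  refine family_apply_mem_closure (z := fun _ : Unit => ρ (genD n)) (fun _ t ht => ?_) ?_ () hv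
  · obtain ⟨c, rfl⟩ := Submodule.mem_span_singleton.1 ht
    refine le_closure ?_
    change ⁅genD n, c • ω⁆ ∈ _
    rw [lie_smul, hω _ (IsPositiveGenerator.D n hn).mem]
    exact Submodule.smul_mem _ _ (Submodule.smul_mem _ _ (Submodule.mem_span_singleton_self ω))
  · rintro _ ⟨m, rfl⟩ v hv ih n
    change ⁅genD _, ⁅genC _, v⁆⁆ ∈ spanC ω
    rw [D_C_apply, hk]
    exact Submodule.add_mem _ (apply_mem_closure (Set.mem_range_self m) (ih n))
      (Submodule.smul_mem _ _ (Submodule.smul_mem _ _ hv))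

theorem genD_mem_spanCA (hk : ∀ v : V, ⁅k, v⁆ = ξ • v) (hω : ∀ u ∈ positive, ⁅u, ω⁆ = f u • ω)
    {n : ℤ} (hn : 0 < n) {v : V} (hv : v ∈ spanCA ω) : ⁅genD n, v⁆ ∈ spanCA ω := by
  refine family_apply_mem_closure (z := fun _ : Unit => ρ (genD n))
    (fun _ t ht => le_closure (genD_mem_spanC hk hω hn ht)) ?_ () hv
  rintro _ ⟨m, rfl⟩ v hv ih n
  change ⁅genD _, ⁅genA _, v⁆⁆ ∈ spanCA ω
  rw [D_A_apply]
  exact Submodule.add_mem _ (apply_mem_closure (Set.mem_range_self m) (ih n))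
    (Submodule.smul_mem _ _ (genA_mem_spanCA hk hω _ hv))

/-- The spanning half of PBW: every generator can be moved past the factors to its left at the cost
of terms already in the span. -/
theorem mem_spanCAD (hk : ∀ v : V, ⁅k, v⁆ = ξ • v) (hω : ∀ u ∈ positive, ⁅u, ω⁆ = f u • ω)
    (hgen : LieSubmodule.lieSpan ℂ TwistedNW {ω} = ⊤) (v : V) : v ∈ spanCAD ω := by
  refine eq_top_of_generator_mem hgen
    (le_closure (le_closure (le_closure (Submodule.mem_span_singleton_self ω)))) ?_ v
  intro u hu v hv
  cases hu with
  | A n =>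
    -- All indices have to be treated together, since passing a d-mode replaces `genA n` by one of
    -- another index.
    refine family_apply_mem_closure (z := fun n => ρ (genA n))
      (fun n t ht => le_closure (genA_mem_spanCA hk hω n ht)) ?_ n hv
    rintro _ ⟨m, rfl⟩ v hv ih n
    change ⁅genA n, ⁅genD _, v⁆⁆ ∈ spanCAD ω
    rw [eq_sub_of_add_eq (D_A_apply _ n v).symm]
    exact Submodule.sub_mem _ (apply_mem_closure (Set.mem_range_self m) (ih n))
      (Submodule.smul_mem _ _ (ih _))
  | C n =>
    refine family_apply_mem_closure (z := fun n => ρ (genC n))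
      (fun n t ht => le_closure (genC_mem_spanCA hω n ht)) ?_ n hv
    rintro _ ⟨m, rfl⟩ v hv ih n
    change ⁅genC n, ⁅genD _, v⁆⁆ ∈ spanCAD ω
    rw [eq_sub_of_add_eq (D_C_apply _ n v).symm, hk]
    exact Submodule.sub_mem _ (apply_mem_closure (Set.mem_range_self m) (ih n))
      (Submodule.smul_mem _ _ (Submodule.smul_mem _ _ hv))
  | D n =>
    rcases lt_or_ge 0 n with hn | hn
    · refine apply_mem_closure_of_commute (z := ρ (genD n))
        (fun t ht => genD_mem_spanCA hk hω hn ht) ?_ hv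
      rintro _ ⟨m, rfl⟩ v
      exact D_D_apply _ _ _
    rcases Int.even_or_odd n with he | ⟨j, hj⟩
    · rw [genD_even he, zero_lie]
      exact Submodule.zero_mem _
    · obtain rfl : n = -(2 * ((-j - 1).toNat : ℤ) + 1) := by lia
      exact apply_mem_closure (Set.mem_range_self _) hv
  | k => rw [hk]; exact Submodule.smul_mem _ _ hv

theorem level_mul_ne_zero (hξ : ξ ≠ 0) (n : ℕ) :
    ((2 * n + 1 : ℤ) : ℂ) * (parity (2 * n + 1) * parity (-(2 * n + 1))) * ξ ≠ 0 := by
  rw [parity_odd ⟨n, rfl⟩, parity_odd ⟨-n - 1, by ring⟩]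
  have : ((2 * n + 1 : ℤ) : ℂ) ≠ 0 := Int.cast_ne_zero.2 (by lia)
  exact mul_ne_zero (mul_ne_zero this (by norm_num)) hξ

/-- For n ≥ 2, `genC n` is minus the bracket of the positive elements `genA (n - 1)` and `genA 1`.
-/
theorem map_genC_eq_zero (hf : ∀ u ∈ positive, ∀ v ∈ positive, f ⁅u, v⁆ = 0) {n : ℤ}
    (hn : 2 ≤ n) : f (genC n) = 0 := by
  have h := hf _ (IsPositiveGenerator.A (n - 1) (by lia)).mem _
    (IsPositiveGenerator.A 1 one_pos).mem
  rw [lie_A_A, if_neg (by lia), zero_smul, add_zero, map_smul, sub_add_cancel] at h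
  simpa using h

/-- A vector on which the positive part acts through `f` is proportional to the generator. -/
theorem mem_span_singleton_of_eigen (hf : ∀ u ∈ positive, ∀ v ∈ positive, f ⁅u, v⁆ = 0)
    (hf1 : f (genC 1) ≠ 0) (hξ : ξ ≠ 0) (hk : ∀ v : V, ⁅k, v⁆ = ξ • v)
    (hω : ∀ u ∈ positive, ⁅u, ω⁆ = f u • ω)
    (hgen : LieSubmodule.lieSpan ℂ TwistedNW {ω} = ⊤) {v : V}
    (hv : ∀ u ∈ positive, ⁅u, v⁆ = f u • v) : v ∈ ℂ ∙ ω := by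
  have hC : ∀ n : ℕ, (0 : ℤ) < 2 * n + 1 := fun n => by lia
  -- The c-modes commute with all A- and c-modes and pair with the d-modes through the level, so
  -- they strip the d-factors.
  have h1 : v ∈ spanCA ω := by
    refine mem_of_forall_eq_zero (y := raiseD V) (U := ⊤)
      (D := fun n => lower V f (genC (2 * n + 1)))
      (c := fun n => ((2 * n + 1 : ℤ) : ℂ) * (parity (2 * n + 1) * parity (-(2 * n + 1))) * ξ)
      (level_mul_ne_zero hξ) le_top (fun _ _ _ => Submodule.mem_top) ?_ ?_ ?_ ?_ ?_
      (mem_spanCAD hk hω hgen v) ?_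
    · intro m n t _
      change ⁅genD _, ⁅genD _, t⁆⁆ - ⁅genD _, ⁅genD _, t⁆⁆ ∈ _
      rw [D_D_apply, sub_self]
      exact Submodule.zero_mem _
    · intro m n k v
      change ⁅genD _, ⁅genD _, ⁅genD _, v⁆⁆⁆ - ⁅genD _, ⁅genD _, ⁅genD _, v⁆⁆⁆ =
        ⁅genD _, ⁅genD _, ⁅genD _, v⁆⁆ - ⁅genD _, ⁅genD _, v⁆⁆⁆
      rw [D_D_apply, sub_self, D_D_apply _ _ v, sub_self, lie_zero]
    · intro n t ht
      exact sub_eq_zero.2 (spanCA_le_eigenC hω ht _ (hC n))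
    · intro m n hmn v _
      simp only [lower_apply, raiseD_apply]
      rw [lie_sub, lie_smul, D_C_apply, if_neg (by lia), zero_smul, add_zero]
    · intro n v _
      simp only [lower_apply, raiseD_apply]
      rw [lie_sub, lie_smul, D_C_apply, if_pos (by lia), hk]
      push_cast
      module
    · intro n
      exact sub_eq_zero.2 (hv _ (IsPositiveGenerator.C _ (hC n)).mem)
  -- The bracket of `genA (n + 1)` with `genA (-m)` is ±`genC (n + 1 - m)` for m ≤ n. On `eigenC`
  -- this acts by zero if m < n and by ±`f (genC 1)` if m = n. For m > n it need not vanish, so the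
  -- pairing is only triangular.
  have h2 : v ∈ spanC ω := by
    refine mem_of_forall_eq_zero (y := raiseA V) (U := eigenC V f)
      (D := fun n => lower V f (genA (n + 1)))
      (c := fun n => (-1 : ℂ) ^ (-n : ℤ) * f (genC 1))
      (fun n => mul_ne_zero (zpow_ne_zero _ (by norm_num)) hf1) (spanC_le_eigenC hω)
      (fun _ _ hu => genA_mem_eigenC _ hu) ?_ ?_ ?_ ?_ ?_ h1 ?_
    · intro m n t ht
      change ⁅genA _, ⁅genA _, t⁆⁆ - ⁅genA _, ⁅genA _, t⁆⁆ ∈ _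
      rw [A_A_apply, add_sub_cancel_left, hk]
      exact Submodule.add_mem _ (Submodule.smul_mem _ _ (genC_mem_spanC hω _ ht))
        (Submodule.smul_mem _ _ (Submodule.smul_mem _ _ ht))
    · intro m n l v
      change ⁅genA _, ⁅genA _, ⁅genA _, v⁆⁆⁆ - ⁅genA _, ⁅genA _, ⁅genA _, v⁆⁆⁆ =
        ⁅genA _, ⁅genA _, ⁅genA _, v⁆⁆ - ⁅genA _, ⁅genA _, v⁆⁆⁆
      rw [A_A_apply, add_sub_cancel_left, A_A_apply _ _ v, add_sub_cancel_left, hk, hk, lie_add,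
        lie_smul, lie_smul, lie_smul, C_A_apply]
    · intro n t ht
      exact sub_eq_zero.2 (genA_apply_spanC hω (by lia) ht)
    · intro m n hmn v hv
      simp only [lower_apply, raiseA_apply]
      rw [lie_sub, lie_smul, A_A_apply, if_neg (by lia), hv _ (by lia),
        map_genC_eq_zero hf (by lia)]
      simp
    · intro n v hv
      simp only [lower_apply, raiseA_apply]
      rw [lie_sub, lie_smul, A_A_apply, if_neg (by lia), hv _ (by lia), zero_smul, add_zero,
        show (n : ℤ) + 1 + -n = 1 by ring, mul_smul]
      abel
    · intro n
      exact sub_eq_zero.2 (hv _ (IsPositiveGenerator.A _ (by lia)).mem)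
  -- The roles of the first round are exchanged: the d-modes strip the c-factors down to the line of
  -- ω.
  refine mem_of_forall_eq_zero (y := raiseC V) (U := ⊤)
      (D := fun n => lower V f (genD (2 * n + 1)))
      (c := fun n => ((2 * n + 1 : ℤ) : ℂ) * (parity (2 * n + 1) * parity (-(2 * n + 1))) * ξ)
      (level_mul_ne_zero hξ) le_top (fun _ _ _ => Submodule.mem_top) ?_ ?_ ?_ ?_ ?_ h2 ?_
  · intro m n t _
    change ⁅genC _, ⁅genC _, t⁆⁆ - ⁅genC _, ⁅genC _, t⁆⁆ ∈ _
    rw [C_C_apply, sub_self]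
    exact Submodule.zero_mem _
  · intro m n k v
    change ⁅genC _, ⁅genC _, ⁅genC _, v⁆⁆⁆ - ⁅genC _, ⁅genC _, ⁅genC _, v⁆⁆⁆ =
      ⁅genC _, ⁅genC _, ⁅genC _, v⁆⁆ - ⁅genC _, ⁅genC _, v⁆⁆⁆
    rw [C_C_apply, sub_self, C_C_apply _ _ v, sub_self, lie_zero]
  · intro n t ht
    obtain ⟨c, rfl⟩ := Submodule.mem_span_singleton.1 ht
    rw [lower_apply, sub_eq_zero, lie_smul, hω _ (IsPositiveGenerator.D _ (hC n)).mem, smul_comm]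
  · intro m n hmn v _
    simp only [lower_apply, raiseC_apply]
    rw [lie_sub, lie_smul, D_C_apply, if_neg (by lia), zero_smul, add_zero]
  · intro n v _
    simp only [lower_apply, raiseC_apply]
    rw [lie_sub, lie_smul, D_C_apply, if_pos (by lia), hk]
    module
  · intro n
    exact sub_eq_zero.2 (hv _ (IsPositiveGenerator.D _ (hC n)).mem)

/-- A nonzero vector of least filtration degree in a nonzero submodule is a Whittaker vector, hence
a nonzero multiple of ω, which generates the module. -/
theorem isIrreducible_of_generator (hf : ∀ u ∈ positive, ∀ v ∈ positive, f ⁅u, v⁆ = 0)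
    (hf1 : f (genC 1) ≠ 0) (hξ : ξ ≠ 0) (hk : ∀ v : V, ⁅k, v⁆ = ξ • v) (hω0 : ω ≠ 0)
    (hω : ∀ u ∈ positive, ⁅u, ω⁆ = f u • ω)
    (hgen : LieSubmodule.lieSpan ℂ TwistedNW {ω} = ⊤) :
    LieModule.IsIrreducible ℂ TwistedNW V := by
  have : Nontrivial V := ⟨ω, 0, hω0⟩
  refine { toNontrivial := inferInstance, eq_bot_or_eq_top := fun N => ?_ }
  refine or_iff_not_imp_left.2 fun hN => ?_
  obtain ⟨w, hwN, hw0⟩ := (Submodule.ne_bot_iff N.toSubmodule).1 (by simpa using hN)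
  classical
  have hex : ∃ n, ∃ v ∈ N, v ≠ 0 ∧ v ∈ whittakerFiltration V f n := by
    obtain ⟨n, hn⟩ := exists_mem_whittakerFiltration hk hω hgen w
    exact ⟨n, w, hwN, hw0, hn⟩
  obtain ⟨v, hvN, hv0, hv⟩ := Nat.find_spec hex
  rcases h : Nat.find hex with _ | n
  · rw [h] at hv
    exact absurd ((Submodule.mem_bot ℂ).1 hv) hv0
  · rw [h, mem_whittakerFiltration_succ] at hv
    have hvω : v ∈ ℂ ∙ ω := by
      refine mem_span_singleton_of_eigen hf hf1 hξ hk hω hgen fun u hu => ?_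
      -- Otherwise (u - f(u))v would be a nonzero vector of the submodule of smaller filtration
      -- degree.
      by_contra hne
      exact Nat.find_min hex (m := n) (by lia) ⟨_, sub_mem (N.lie_mem hvN) (N.smul_mem _ hvN),
        sub_ne_zero.2 hne, hv u hu⟩
    obtain ⟨c, rfl⟩ := Submodule.mem_span_singleton.1 hvω
    have hc : c ≠ 0 := fun hc => hv0 (by rw [hc, zero_smul])
    rw [← top_le_iff, ← hgen, LieSubmodule.lieSpan_le, Set.singleton_subset_iff]
    have := N.smul_mem c⁻¹ hvN
    rwa [inv_smul_smul₀ hc] at this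

/-- The operator u - f(u) lowers the filtration degree but acts on v by the scalar f'(u) - f(u). If
that scalar were nonzero, the degree of v would not be minimal. -/
theorem eigenvalue_eq (hk : ∀ v : V, ⁅k, v⁆ = ξ • v)
    (hω : ∀ u ∈ positive, ⁅u, ω⁆ = f u • ω)
    (hgen : LieSubmodule.lieSpan ℂ TwistedNW {ω} = ⊤) {f' : TwistedNW → ℂ} {v : V} (hv0 : v ≠ 0)
    (hv : ∀ u ∈ positive, ⁅u, v⁆ = f' u • v) {u : TwistedNW} (hu : u ∈ positive) :
    f' u = f u := by
  classical
  have hex := exists_mem_whittakerFiltration hk hω hgen v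
  have hn := Nat.find_spec hex
  rcases h : Nat.find hex with _ | n
  · rw [h] at hn
    exact absurd ((Submodule.mem_bot ℂ).1 hn) hv0
  · rw [h, mem_whittakerFiltration_succ] at hn
    have h1 := hn u hu
    rw [hv u hu, ← sub_smul] at h1
    by_contra hne
    exact Nat.find_min hex (m := n) (by lia)
      ((Submodule.smul_mem_iff _ (sub_ne_zero.2 hne)).1 h1)

end WhittakerVectors

end TwistedNW

/-! ### Extending a character of a subalgebra to a module over the whole Lie algebra -/

theorem InducedMonomials.op_single_zero {R g J K : Type*} [CommRing R] [LieRing g] [LieAlgebra R g]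
    [LinearOrder J] (b : Module.Basis (J ⊕ K) R g) {P : Submodule R g} (bP : Module.Basis K R P)
    (hb : ∀ i, b (.inr i) = bP i) (f : g →ₗ[R] R) {u : g} (hu : u ∈ P) :
    op b (fun i => f (bP i)) u (Finsupp.single 0 1) =
      f u • (Finsupp.single 0 1 : Multiset J →₀ R) := by
  have h : (op b fun i => f (bP i)).flip (Finsupp.single 0 1) ∘ₗ P.subtype =
      (f ∘ₗ P.subtype).smulRight (Finsupp.single 0 1 : Multiset J →₀ R) := by
    refine bP.ext fun i => ?_
    change op b (fun i => f (bP i)) (bP i : g) (Finsupp.single 0 1) = f (bP i) • _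
    rw [← hb, op_inr_single, hb]
  exact LinearMap.congr_fun h ⟨u, hu⟩

universe u v

/-- A character of a subalgebra occurs in some module over the whole Lie algebra. -/
theorem LieSubalgebra.exists_eigenvector {𝕜 : Type u} {g : Type v} [Field 𝕜] [LieRing g]
    [LieAlgebra 𝕜 g] (P : LieSubalgebra 𝕜 g) (f : g →ₗ[𝕜] 𝕜)
    (hf : ∀ u ∈ P, ∀ v ∈ P, f ⁅u, v⁆ = 0) :
    ∃ (J : Type v) (_ : LieRingModule g (Multiset J →₀ 𝕜)) (_ : LieModule 𝕜 g (Multiset J →₀ 𝕜))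
      (w : Multiset J →₀ 𝕜), w ≠ 0 ∧ ∀ u ∈ P, ⁅u, w⁆ = f u • w := by
  classical
  obtain ⟨Q, hQ⟩ := P.toSubmodule.exists_isCompl
  obtain ⟨J, ⟨bQ⟩⟩ : ∃ J : Type v, Nonempty (Module.Basis J 𝕜 Q) :=
    ⟨_, ⟨Module.Basis.ofVectorSpace 𝕜 Q⟩⟩
  obtain ⟨K, ⟨bP⟩⟩ : ∃ K : Type v, Nonempty (Module.Basis K 𝕜 P.toSubmodule) :=
    ⟨_, ⟨Module.Basis.ofVectorSpace 𝕜 P.toSubmodule⟩⟩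
  obtain ⟨b, hb⟩ : ∃ b : Module.Basis (J ⊕ K) 𝕜 g, ∀ i, b (.inr i) = bP i :=
    ⟨(bQ.prod bP).map (Submodule.prodEquivOfIsCompl Q P.toSubmodule hQ.symm), fun i => by simp⟩
  -- Any linear order serves to sort the monomials.
  let : LinearOrder J := linearOrderOfSTO WellOrderingRel
  have hop := fun {u} (hu : u ∈ P.toSubmodule) => InducedMonomials.op_single_zero b bP hb f hu
  have hχ : ∀ i j, InducedMonomials.op b (fun i => f (bP i)) ⁅b (.inr i), b (.inr j)⁆
      (Finsupp.single 0 1) = 0 := by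
    intro i j
    rw [hb, hb, hop (P.lie_mem (bP i).2 (bP j).2), hf _ (bP i).2 _ (bP j).2, zero_smul]
  exact ⟨J, InducedMonomials.lieRingModule b _ hχ, InducedMonomials.lieModule b _ hχ,
    Finsupp.single 0 1, by simp, fun u hu => hop hu⟩

/-! ### The universal property of induced modules -/

section Induced

attribute [local instance 100] LieRing.ofAssociativeRing

/-- The universal property gives an algebra map into `S` whose composite with the inclusion fixes
the image of `L`, hence is the identity. -/
theorem UniversalEnvelopingAlgebra.subalgebra_eq_top {R L : Type*} [CommRing R] [LieRing L]
    [LieAlgebra R L] (S : Subalgebra R (UniversalEnvelopingAlgebra R L))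
    (hS : ∀ x, UniversalEnvelopingAlgebra.ι R x ∈ S) : S = ⊤ := by
  let j : L →ₗ⁅R⁆ S :=
    { toFun := fun x => ⟨UniversalEnvelopingAlgebra.ι R x, hS x⟩
      map_add' := fun x y => Subtype.ext (map_add _ x y)
      map_smul' := fun r x => Subtype.ext (map_smul _ r x)
      map_lie' := fun {x y} => Subtype.ext (LieHom.map_lie (UniversalEnvelopingAlgebra.ι R) x y) }
  have h : S.val.comp (UniversalEnvelopingAlgebra.lift R j) = AlgHom.id R _ := by
    refine UniversalEnvelopingAlgebra.hom_ext R (LieHom.ext fun x => ?_)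
    change ((UniversalEnvelopingAlgebra.lift R j (UniversalEnvelopingAlgebra.ι R x) : S) :
      UniversalEnvelopingAlgebra R L) = UniversalEnvelopingAlgebra.ι R x
    rw [UniversalEnvelopingAlgebra.lift_ι_apply]
    rfl
  refine eq_top_iff.2 fun a _ => ?_
  have := AlgHom.congr_fun h a
  rw [AlgHom.id_apply] at this
  rw [← this]
  exact (UniversalEnvelopingAlgebra.lift R j a).2

namespace InducedModule

variable {R L V : Type*} [CommRing R] [LieRing L] [LieAlgebra R L] {K : LieSubalgebra R L}
  [AddCommGroup V] [Module R V] [LieRingModule K V] [LieModule R K V]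

theorem lie_def (x : L) (m : InducedModule R L V K) :
    ⁅x, m⁆ = UniversalEnvelopingAlgebra.ι R x • m := rfl

theorem smul_tmul (a u : UniversalEnvelopingAlgebra R L) (v : V) :
    a • tmul R L V K u v = tmul R L V K (a * u) v := rfl

theorem smul_mem {N : LieSubmodule R L (InducedModule R L V K)}
    (a : UniversalEnvelopingAlgebra R L) {m : InducedModule R L V K} (hm : m ∈ N) : a • m ∈ N := by
  let S : Subalgebra R (UniversalEnvelopingAlgebra R L) :=
    { carrier := {a | ∀ m ∈ N, a • m ∈ N}
      mul_mem' := fun ha hb m hm => by rw [mul_smul]; exact ha _ (hb m hm)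
      add_mem' := fun ha hb m hm => by rw [add_smul]; exact add_mem (ha m hm) (hb m hm)
      algebraMap_mem' := fun r m hm => by
        rw [algebraMap_smul]; exact N.smul_mem r hm }
  have hS : S = ⊤ := UniversalEnvelopingAlgebra.subalgebra_eq_top S fun x m hm => N.lie_mem hm
  have ha : a ∈ S := by rw [hS]; trivial
  exact ha m hm

theorem eq_top_of_tmul_one_mem {N : LieSubmodule R L (InducedModule R L V K)}
    (h : ∀ v, tmul R L V K 1 v ∈ N) : N = ⊤ := by
  rw [eq_top_iff]
  intro m _
  obtain ⟨t, rfl⟩ := Submodule.Quotient.mk_surjective _ m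
  induction t using TensorProduct.induction_on with
  | zero => exact N.zero_mem
  | add s t hs ht => exact N.add_mem (hs trivial) (ht trivial)
  | tmul u v =>
    have : tmul R L V K u v ∈ N := by
      rw [← mul_one u, ← smul_tmul]
      exact smul_mem u (h v)
    exact this

theorem lie_tmul_one (x : K) (v : V) :
    ⁅(x : L), tmul R L V K 1 v⁆ = tmul R L V K 1 ⁅x, v⁆ := by
  refine (Submodule.Quotient.eq _).2 (Submodule.subset_span
    ⟨1, UniversalEnvelopingAlgebra.ι R x, v, ?_⟩)
  rw [envelopingIncl, envelopingAct, UniversalEnvelopingAlgebra.lift_ι_apply,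
    UniversalEnvelopingAlgebra.lift_ι_apply, one_mul]
  change (UniversalEnvelopingAlgebra.ι R (x : L) * 1) ⊗ₜ[R] v - _ = _
  rw [mul_one]
  rfl

variable {M : Type*} [AddCommGroup M] [Module R M] [LieRingModule L M] [LieModule R L M]

/-- The map `U(L) ⊗ V → M` that extends a linear map `V → M`. -/
def tensorLift (j : V →ₗ[R] M) : UniversalEnvelopingAlgebra R L ⊗[R] V →ₗ[R] M :=
  TensorProduct.lift ((LinearMap.lcomp R M j) ∘ₗ
    (UniversalEnvelopingAlgebra.lift R (LieModule.toEnd R L M)).toLinearMap)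

theorem tensorLift_tmul (j : V →ₗ[R] M) (u : UniversalEnvelopingAlgebra R L) (v : V) :
    tensorLift j (u ⊗ₜ v) = UniversalEnvelopingAlgebra.lift R (LieModule.toEnd R L M) u (j v) := rfl

theorem tensorLift_smul (j : V →ₗ[R] M) (a : UniversalEnvelopingAlgebra R L)
    (t : UniversalEnvelopingAlgebra R L ⊗[R] V) : tensorLift j (a • t) =
      UniversalEnvelopingAlgebra.lift R (LieModule.toEnd R L M) a (tensorLift j t) := by
  induction t using TensorProduct.induction_on with
  | zero => simp
  | add s t hs ht => rw [smul_add, map_add, map_add, map_add, hs, ht]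
  | tmul u v =>
    rw [TensorProduct.smul_tmul', tensorLift_tmul, tensorLift_tmul, smul_eq_mul, map_mul]
    rfl

/-- The `s` that intertwine form a subalgebra of U(K) containing `K`. This makes the extension of
`j` respect the balancing relations. -/
theorem lift_incl_apply (j : V →ₗ[R] M) (hj : ∀ (x : K) v, j ⁅x, v⁆ = ⁅(x : L), j v⁆)
    (s : UniversalEnvelopingAlgebra R K) : ∀ v,
    UniversalEnvelopingAlgebra.lift R (LieModule.toEnd R L M) (envelopingIncl R L K s) (j v) =
      j (envelopingAct R L V K s v) := by
  let S : Subalgebra R (UniversalEnvelopingAlgebra R K) :=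
    { carrier := {s | ∀ v, UniversalEnvelopingAlgebra.lift R (LieModule.toEnd R L M)
        (envelopingIncl R L K s) (j v) = j (envelopingAct R L V K s v)}
      mul_mem' := fun {s t} hs ht v => by
        rw [map_mul, map_mul, map_mul, Module.End.mul_apply, Module.End.mul_apply, ht, hs]
      add_mem' := fun {s t} hs ht v => by
        rw [map_add, map_add, map_add, LinearMap.add_apply, LinearMap.add_apply, hs, ht, map_add]
      algebraMap_mem' := fun r v => by
        rw [AlgHom.commutes, AlgHom.commutes, AlgHom.commutes, Module.algebraMap_end_apply,
          Module.algebraMap_end_apply, map_smul] }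
  have hS : S = ⊤ := UniversalEnvelopingAlgebra.subalgebra_eq_top S fun x v => by
    rw [envelopingIncl, envelopingAct, UniversalEnvelopingAlgebra.lift_ι_apply,
      UniversalEnvelopingAlgebra.lift_ι_apply, LieHom.comp_apply,
      UniversalEnvelopingAlgebra.lift_ι_apply]
    exact (hj x v).symm
  have hs : s ∈ S := by rw [hS]; trivial
  exact hs

theorem tensorLift_eq_zero (j : V →ₗ[R] M) (hj : ∀ (x : K) v, j ⁅x, v⁆ = ⁅(x : L), j v⁆)
    {t : UniversalEnvelopingAlgebra R L ⊗[R] V} (ht : t ∈ inducedRelations R L V K) :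
    tensorLift j t = 0 := by
  induction ht using Submodule.span_induction with
  | mem t ht =>
    obtain ⟨u, s, v, rfl⟩ := ht
    rw [map_sub, tensorLift_tmul, tensorLift_tmul, map_mul, Module.End.mul_apply,
      lift_incl_apply j hj, sub_self]
  | zero => exact map_zero _
  | add s t _ _ hs ht => rw [map_add, hs, ht, add_zero]
  | smul a t _ ht => rw [tensorLift_smul, ht, map_zero]

/-- The universal property of the induced module. -/
def lift (j : V →ₗ[R] M) (hj : ∀ (x : K) v, j ⁅x, v⁆ = ⁅(x : L), j v⁆) :
    InducedModule R L V K →ₗ⁅R,L⁆ M where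
  toLinearMap := (((inducedRelations R L V K).restrictScalars R).liftQ (tensorLift j)
    fun _ ht => tensorLift_eq_zero j hj ht) ∘ₗ
      (Submodule.Quotient.restrictScalarsEquiv R (inducedRelations R L V K)).symm.toLinearMap
  map_lie' {x m} := by
    obtain ⟨t, rfl⟩ := Submodule.Quotient.mk_surjective _ m
    change tensorLift j (UniversalEnvelopingAlgebra.ι R x • t) = ⁅x, tensorLift j t⁆
    rw [tensorLift_smul, UniversalEnvelopingAlgebra.lift_ι_apply]
    rfl

theorem lift_tmul_one (j : V →ₗ[R] M) (hj : ∀ (x : K) v, j ⁅x, v⁆ = ⁅(x : L), j v⁆) (v : V) :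
    lift j hj (tmul R L V K 1 v) = j v := by
  change tensorLift j (1 ⊗ₜ v) = j v
  rw [tensorLift_tmul, map_one, Module.End.one_apply]

end InducedModule

end Induced

/-- The map induced on a quotient of Lie modules. -/
def LieSubmodule.Quotient.liftHom {R L M M' : Type*} [CommRing R] [LieRing L] [LieAlgebra R L]
    [AddCommGroup M] [Module R M] [LieRingModule L M] [LieModule R L M]
    [AddCommGroup M'] [Module R M'] [LieRingModule L M']
    (N : LieSubmodule R L M) (F : M →ₗ⁅R,L⁆ M') (hF : ∀ m ∈ N, F m = 0) : M ⧸ N →ₗ⁅R,L⁆ M' where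
  toLinearMap := N.toSubmodule.liftQ (F : M →ₗ[R] M') hF
  map_lie' {x m} := by
    obtain ⟨m, rfl⟩ := LieSubmodule.Quotient.surjective_mk' N m
    exact F.map_lie x m

theorem CharModule.exists_smul_one {N : Type*} [LieRing N] [LieAlgebra ℂ N]
    (ψ : LieAlgebra.LieCharacter ℂ N) (v : CharModule ψ) : ∃ z : ℂ, z • one ψ = v :=
  ⟨v, mul_one (M := ℂ) v⟩

/-! ### The module L_{ψ,ξ}: generation, universal property, nonvanishing -/

namespace TwistedNW

theorem k_lie (u : TwistedNW) : ⁅k, u⁆ = 0 := by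
  rw [← lie_skew, lie_k, neg_zero]

variable (ψ : LieAlgebra.LieCharacter ℂ positive) (ξ : ℂ)

theorem k_lie_quotient (v : WhittakerQuotient ψ ξ) : ⁅k, v⁆ = ξ • v := by
  obtain ⟨m, rfl⟩ := LieSubmodule.Quotient.surjective_mk' _ v
  rw [← sub_eq_zero, ← LieModuleHom.map_lie, ← map_smul, ← map_sub,
    LieSubmodule.Quotient.mk_eq_zero]
  exact ⟨m, rfl⟩

theorem lie_omegaBar (x : positive) :
    ⁅(x : TwistedNW), omegaBar ψ ξ⁆ = ψ x • omegaBar ψ ξ := by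
  change ⁅(x : TwistedNW), LieSubmodule.Quotient.mk' (kSubScalar ψ ξ) _⁆ =
    ψ x • LieSubmodule.Quotient.mk' (kSubScalar ψ ξ) _
  rw [← LieModuleHom.map_lie, ← map_smul, InducedModule.lie_tmul_one]
  change LieSubmodule.Quotient.mk' (kSubScalar ψ ξ)
    (Submodule.Quotient.mk (1 ⊗ₜ[ℂ] (ψ x • CharModule.one ψ))) = _
  rw [TensorProduct.tmul_smul]
  rfl

theorem lieSpan_omegaBar : LieSubmodule.lieSpan ℂ TwistedNW {omegaBar ψ ξ} = ⊤ := by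
  have h : (LieSubmodule.lieSpan ℂ TwistedNW {omegaBar ψ ξ}).comap
      (LieSubmodule.Quotient.mk' (kSubScalar ψ ξ)) = ⊤ := by
    refine InducedModule.eq_top_of_tmul_one_mem fun v => ?_
    obtain ⟨z, rfl⟩ := CharModule.exists_smul_one ψ v
    have hv : InducedModule.tmul ℂ TwistedNW (CharModule ψ) positive 1 (z • CharModule.one ψ) =
        z • InducedModule.tmul ℂ TwistedNW (CharModule ψ) positive 1 (CharModule.one ψ) :=
      congrArg Submodule.Quotient.mk (TensorProduct.tmul_smul z _ _)
    rw [hv]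
    exact Submodule.smul_mem (LieSubmodule.toSubmodule _) _
      (LieSubmodule.subset_lieSpan (Set.mem_singleton _))
  rw [eq_top_iff]
  intro v _
  obtain ⟨m, rfl⟩ := LieSubmodule.Quotient.surjective_mk' _ v
  have hm : m ∈ (⊤ : LieSubmodule ℂ TwistedNW (UniversalWhittaker ψ)) := trivial
  rw [← h] at hm
  exact hm

variable {ψ ξ} in
/-- The quotient `L_{ψ,ξ}` maps to every module with a suitable vector. -/
theorem exists_hom {M : Type*} [AddCommGroup M] [Module ℂ M] [LieRingModule TwistedNW M]
    [LieModule ℂ TwistedNW M] {w : M} (hw : ∀ x : positive, ⁅(x : TwistedNW), w⁆ = ψ x • w)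
    (hk : ⁅(k : TwistedNW), w⁆ = ξ • w) :
    ∃ F : WhittakerQuotient ψ ξ →ₗ⁅ℂ, TwistedNW⁆ M, F (omegaBar ψ ξ) = w := by
  let j : CharModule ψ →ₗ[ℂ] M := LinearMap.toSpanSingleton ℂ M w
  have hone : j (CharModule.one ψ) = w := one_smul ℂ w
  have hj : ∀ (x : positive) v, j ⁅x, v⁆ = ⁅(x : TwistedNW), j v⁆ := by
    intro x v
    change j (ψ x • v) = _
    obtain ⟨z, rfl⟩ := CharModule.exists_smul_one ψ v
    rw [map_smul, map_smul, hone, lie_smul, hw, smul_comm]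
  let F := InducedModule.lift j hj
  -- The level is assumed only at `w`. As `k` is central, the vectors whose image has level ξ form a
  -- submodule, and it contains the generator.
  have hF : ∀ m, ⁅(k : TwistedNW), F m⁆ = ξ • F m := by
    let N : LieSubmodule ℂ TwistedNW (UniversalWhittaker ψ) :=
      { LinearMap.ker ((LieModule.toEnd ℂ TwistedNW M k - ξ • (1 : Module.End ℂ M)) ∘ₗ
          (F : UniversalWhittaker ψ →ₗ[ℂ] M)) with
        lie_mem := fun {x m} hm => by
          have hm' : ⁅(k : TwistedNW), F m⁆ - ξ • F m = 0 := hm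
          change ⁅(k : TwistedNW), F ⁅x, m⁆⁆ - ξ • F ⁅x, m⁆ = 0
          rw [LieModuleHom.map_lie, leibniz_lie, k_lie, zero_lie, zero_add,
            ← lie_smul, ← lie_sub, hm', lie_zero] }
    have hN : N = ⊤ := InducedModule.eq_top_of_tmul_one_mem fun v => by
      obtain ⟨z, rfl⟩ := CharModule.exists_smul_one ψ v
      change ⁅(k : TwistedNW), F (InducedModule.tmul ℂ TwistedNW (CharModule ψ) positive 1 _)⁆ -
        ξ • F (InducedModule.tmul ℂ TwistedNW (CharModule ψ) positive 1 _) = 0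
      rw [InducedModule.lift_tmul_one, map_smul, hone, lie_smul, hk, smul_comm, sub_self]
    intro m
    have hm : m ∈ N := by rw [hN]; trivial
    exact sub_eq_zero.1 hm
  refine ⟨LieSubmodule.Quotient.liftHom (kSubScalar ψ ξ) F ?_, ?_⟩
  · rintro _ ⟨m, rfl⟩
    change F (⁅(k : TwistedNW), m⁆ - ξ • m) = 0
    rw [map_sub, map_smul, LieModuleHom.map_lie, hF, sub_self]
  · exact (InducedModule.lift_tmul_one j hj _).trans hone

/-- Allows a functional to be given any value at `k` by adding a multiple of `central`, without
changing it on the positive part. -/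
theorem central_eq_zero_of_mem_positive {u : TwistedNW} (hu : u ∈ positive) :
    AffineNW.central (u : AffineNW) = 0 := by
  change u ∈ Submodule.span ℂ positiveModes at hu
  induction hu using Submodule.span_induction with
  | mem u hu =>
    obtain ⟨n, x, -, -, h⟩ := exists_of_mem_positiveModes hu
    rw [h]
    rfl
  | zero => exact map_zero _
  | add u v _ _ hu hv => exact (map_add _ _ _).trans (by rw [hu, hv, add_zero])
  | smul c u _ hu => exact (map_smul _ _ _).trans (by rw [hu, smul_zero])

/-- A linear extension of the character with a prescribed value at `k`. -/
theorem exists_extension : ∃ f : TwistedNW →ₗ[ℂ] ℂ, (∀ x : positive, f x = ψ x) ∧ f k = ξ := by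
  obtain ⟨f, hf⟩ := LinearMap.exists_extend (p := positive.toSubmodule) (ψ : positive →ₗ[ℂ] ℂ)
  refine ⟨f + (ξ - f k) • (AffineNW.central ∘ₗ TwistedNW.toSubmodule.subtype), fun x => ?_, ?_⟩
  · have h1 : f x = ψ x := LinearMap.congr_fun hf x
    have h2 : AffineNW.central ((x : TwistedNW) : AffineNW) = 0 :=
      central_eq_zero_of_mem_positive x.2
    change f x + (ξ - f k) * AffineNW.central ((x : TwistedNW) : AffineNW) = ψ x
    rw [h1, h2, mul_zero, add_zero]
  · change f k + (ξ - f k) * 1 = ξ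
    ring

/-- The sum of the positive part and the center. -/
def positiveCentral : LieSubalgebra ℂ TwistedNW where
  __ := positive.toSubmodule ⊔ ℂ ∙ k
  lie_mem' {u v} hu hv := by
    obtain ⟨x, hx, _, hc, rfl⟩ := Submodule.mem_sup.1 hu
    obtain ⟨c, rfl⟩ := Submodule.mem_span_singleton.1 hc
    obtain ⟨y, hy, _, hd, rfl⟩ := Submodule.mem_sup.1 hv
    obtain ⟨d, rfl⟩ := Submodule.mem_span_singleton.1 hd
    refine Submodule.mem_sup_left ?_
    rw [lie_add, add_lie, lie_smul, lie_k, smul_zero, add_zero, smul_lie, k_lie, smul_zero,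
      add_zero]
    exact positive.lie_mem hx hy

/-- The extended functional is a character of g⁺ ⊕ ℂk, so it occurs in some module on a nonzero
vector, and `exists_hom` sends the generator to that vector. -/
theorem omegaBar_ne_zero : omegaBar ψ ξ ≠ 0 := by
  obtain ⟨f, hf, hfk⟩ := exists_extension ψ ξ
  obtain ⟨J, _, _, w, hw0, hw⟩ := positiveCentral.exists_eigenvector f (by
    intro u hu v hv
    obtain ⟨x, hx, _, hc, rfl⟩ := Submodule.mem_sup.1 hu
    obtain ⟨c, rfl⟩ := Submodule.mem_span_singleton.1 hc
    obtain ⟨y, hy, _, hd, rfl⟩ := Submodule.mem_sup.1 hv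
    obtain ⟨d, rfl⟩ := Submodule.mem_span_singleton.1 hd
    rw [lie_add, add_lie, lie_smul, lie_k, smul_zero, add_zero, smul_lie, k_lie, smul_zero,
      add_zero]
    exact (hf ⁅(⟨x, hx⟩ : positive), ⟨y, hy⟩⁆).trans (LieAlgebra.lieCharacter_apply_lie ψ _ _))
  obtain ⟨F, hF⟩ := exists_hom (ψ := ψ) (ξ := ξ) (w := w)
    (fun x => by rw [hw _ (Submodule.mem_sup_left x.2), hf])
    (by rw [hw _ (Submodule.mem_sup_right (Submodule.mem_span_singleton_self k)), hfk])
  intro h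
  rw [h, map_zero] at hF
  exact hw0 hF.symm

end TwistedNW

end

/-! ### The theorem -/

open TwistedNW in
theorem theorem3p7 (ψ : LieAlgebra.LieCharacter ℂ TwistedNW.positive)
    (hψ : ψ TwistedNW.cOnePos ≠ 0) (ξ : ℂ) (hξ : ξ ≠ 0) :
    (∀ v : WhittakerQuotient ψ ξ,
      IsWhittakerVector ψ v ↔ ∃ u : ℂ, u ≠ 0 ∧ v = u • omegaBar ψ ξ) ∧
    (∀ v : WhittakerQuotient ψ ξ,
      (∃ ψ' : LieAlgebra.LieCharacter ℂ TwistedNW.positive, IsWhittakerVector ψ' v) ↔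
        ∃ u : ℂ, u ≠ 0 ∧ v = u • omegaBar ψ ξ) ∧
    LieModule.IsIrreducible ℂ TwistedNW (WhittakerQuotient ψ ξ) ∧
    (∀ (M : Type*) [AddCommGroup M] [Module ℂ M] [LieRingModule TwistedNW M]
      [LieModule ℂ TwistedNW M], IsWhittakerModule M ψ → (∀ m : M, ⁅TwistedNW.k, m⁆ = ξ • m) →
        LieModule.IsIrreducible ℂ TwistedNW M ∧
        Nonempty (M ≃ₗ⁅ℂ, TwistedNW⁆ WhittakerQuotient ψ ξ)) := by
  obtain ⟨f, hfψ, -⟩ := exists_extension ψ ξ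
  have hf : ∀ u ∈ positive, ∀ v ∈ positive, f ⁅u, v⁆ = 0 := fun u hu v hv =>
    (hfψ ⁅(⟨u, hu⟩ : positive), ⟨v, hv⟩⁆).trans (LieAlgebra.lieCharacter_apply_lie ψ _ _)
  have hf1 : f (genC 1) ≠ 0 := by
    have h : genC 1 = (2 : ℂ) • cOne := by
      apply Subtype.ext
      change AffineNW.mode _ 1 = (2 : ℂ) • AffineNW.mode _ 1
      rw [← AffineNW.mode_smul, parity_odd odd_one]
      congr 1
      ext <;> simp [NappiWitten.c]
    rw [h, map_smul]
    exact smul_ne_zero two_ne_zero (by rw [show f cOne = ψ cOnePos from hfψ cOnePos]; exact hψ)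
  have hkL := k_lie_quotient ψ ξ
  have hgenL := lieSpan_omegaBar ψ ξ
  have hωL : ∀ u ∈ positive, ⁅u, omegaBar ψ ξ⁆ = f u • omegaBar ψ ξ := fun u hu => by
    rw [show f u = ψ ⟨u, hu⟩ from hfψ ⟨u, hu⟩]
    exact lie_omegaBar ψ ξ ⟨u, hu⟩
  have hω0 := omegaBar_ne_zero ψ ξ
  have hirr := isIrreducible_of_generator hf hf1 hξ hkL hω0 hωL hgenL
  have h1 : ∀ v : WhittakerQuotient ψ ξ,
      IsWhittakerVector ψ v ↔ ∃ u : ℂ, u ≠ 0 ∧ v = u • omegaBar ψ ξ := by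
    refine fun v => ⟨fun ⟨hv0, hv⟩ => ?_, ?_⟩
    · obtain ⟨c, rfl⟩ := Submodule.mem_span_singleton.1
        (mem_span_singleton_of_eigen hf hf1 hξ hkL hωL hgenL (v := v) fun u hu => by
          rw [show f u = ψ ⟨u, hu⟩ from hfψ ⟨u, hu⟩]
          exact hv ⟨u, hu⟩)
      exact ⟨c, fun hc => hv0 (by rw [hc, zero_smul]), rfl⟩
    · rintro ⟨c, hc, rfl⟩
      exact ⟨smul_ne_zero hc hω0, fun x => by rw [lie_smul, lie_omegaBar, smul_comm]⟩
  refine ⟨h1, fun v => ⟨fun ⟨ψ', hv0, hv⟩ => ?_, fun h => ⟨ψ, (h1 v).2 h⟩⟩, hirr, ?_⟩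
  · obtain ⟨f', hf', -⟩ := exists_extension ψ' ξ
    refine (h1 v).1 ⟨hv0, fun x => ?_⟩
    -- The type of a Whittaker vector is forced, which reduces the second equivalence to the first.
    have hx : f' x = f x := eigenvalue_eq hkL hωL hgenL (f' := f') hv0 (fun u hu => by
      rw [show f' u = ψ' ⟨u, hu⟩ from hf' ⟨u, hu⟩]
      exact hv ⟨u, hu⟩) x.2
    rw [hv x, ← hf', hx, hfψ]
  · intro M _ _ _ _ ⟨ω, ⟨hω0', hω⟩, hgen⟩ hk
    refine ⟨isIrreducible_of_generator hf hf1 hξ hk hω0' (fun u hu => ?_) hgen, ?_⟩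
    · rw [show f u = ψ ⟨u, hu⟩ from hfψ ⟨u, hu⟩]
      exact hω ⟨u, hu⟩
    obtain ⟨F, hF⟩ := exists_hom hω (hk ω)
    -- The kernel is a proper submodule of the irreducible L_{ψ,ξ}, because its generator goes to ω
    -- ≠ 0.
    have hinj : Function.Injective F := by
      refine (LieModuleHom.ker_eq_bot F).1 ((hirr.eq_bot_or_eq_top F.ker).resolve_right fun h => ?_)
      have : omegaBar ψ ξ ∈ F.ker := by rw [h]; trivial
      rw [LieModuleHom.mem_ker, hF] at this
      exact hω0' this
    have hsurj : Function.Surjective F := by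
      rw [← LieModuleHom.range_eq_top, ← top_le_iff, ← hgen, LieSubmodule.lieSpan_le,
        Set.singleton_subset_iff]
      exact ⟨omegaBar ψ ξ, hF⟩
    let e := LinearEquiv.ofBijective (F : WhittakerQuotient ψ ξ →ₗ[ℂ] M) ⟨hinj, hsurj⟩
    exact ⟨({ F with
      invFun := e.symm
      left_inv := e.symm_apply_apply
      right_inv := e.apply_symm_apply } : WhittakerQuotient ψ ξ ≃ₗ⁅ℂ, TwistedNW⁆ M).symm⟩
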